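/- Let $k$ be a field and let $\mathcal T=k\langle g,h\rangle$ be the free algebra, a bialgebra with $\Delta(g)=g\otimes g$, $\Delta(h)=1\otimes h+h\otimes g$, $\epsilon(g)=1$, $\epsilon(h)=0$. Order words in $g,h$ lexicographically with $g\prec h$; a nonempty word $\alpha$ is a Lyndon word if $\alpha\prec\gamma\beta$ for every factorization $\alpha=\beta\gamma$ into nonempty words. For Lyndon words put $E_g=g$, $E_h=h$, and $E_\alpha=E_\beta E_\gamma-E_\gamma E_\beta$ if $\alpha$ has length at least $2$ and $\alpha=\beta\gamma$ is the factorization into Lyndon words with $\gamma$ of maximal length. Let $\overline{\mathcal T}=\mathcal T/\mathcal I$, where $\mathcal I$ is the two-sided ideal generated by all $E_\alpha$ with $\alpha$ a Lyndon word containing the letter $g$ at least twice. Let $\mathcal E_n\in\overline{\mathcal T}$ be the image of $E_{gh^n}$ (with $gh^n$ the word $g$ followed by $n$ letters $h$), $n\ge 0$, write $h$ also for the image of $h$, and let $R$ be the subalgebra of $\overline{\mathcal T}$ generated by $\{\mathcal E_n : n\ge 0\}$. Let $\mathcal B_{\mathrm{FdB}}=k[u_1,u_2,\dots]$ be the polynomial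 algebra with the algebra maps $$\epsilon(u_n)=\delta_{n,1},\qquad \Delta(u_n)=\sum_{j=1}^n u_j\otimes B_{n,j}(u_1,\dots,u_n),$$ $$B_{n,j}(u_1,\dots,u_n)=\sum_{\substack{c_1+\dots+c_n=j\\ c_1+2c_2+\dots+nc_n=n}}\frac{n!}{\prod_{i}c_i!\,(i!)^{c_i}}\;u_1^{c_1}\cdots u_n^{c_n}$$ (the coefficients are integers). Then: 1. There is a bialgebra structure on the algebra $\overline{\mathcal T}$ for which the projection $\mathcal T\to\overline{\mathcal T}$ is a morphism of bialgebras, and $\overline{\mathcal T}$ is pointed: its coradical (the sum of its simple subcoalgebras) is spanned by the grouplike elements. 2. $\overline{\mathcal T}=R[h;\operatorname{ad}_r h]$ is an Ore extension of $R$: the map $\operatorname{ad}_r h(a)=ah-ha$ is a nonzero derivation $R\to R$, $h\notin R$, $ah=ha+\operatorname{ad}_r h(a)$ for $a\in R$, and every element of $\overline{\mathcal T}$ is uniquely of the form $\sum_i h^i a_i$ with $a_i\in R$, almost all zero. 3. $R$ is a commutative sub-bialgebra of $\overline{\mathcal T}$, $\mathcal B_{\mathrm{FdB}}$ is a bialgebra,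 and there is an isomorphism of bialgebras $\mathcal B_{\mathrm{FdB}}\to R$ with $u_{n+1}\mapsto\mathcal E_n$ for all $n\ge 0$. In particular $\overline{\mathcal T}$ is an Ore extension of (a copy of) the Faà di Bruno bialgebra. 4. If $k$ has characteristic $0$, then $R\cong\mathcal B_{\mathrm{FdB}}$ is a maximal commutative sub-bialgebra of $\overline{\mathcal T}$, i.e. maximal under inclusion among the commutative sub-bialgebras of $\overline{\mathcal T}$. -/

import Mathlib

open scoped TensorProduct

noncomputable section

namespace FaaDiBrunoOre

/-! ### Coalgebra notions over a field

All notions below are stated for a comultiplication and a counit (`CoalgebraStruct`); the laws are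
collected in the predicate `IsBialgebra`. -/

section General

open CoalgebraStruct

/-- The comultiplication and counit make the algebra `A` a bialgebra. -/
structure IsBialgebra (k A : Type*) [Field k] [Ring A] [Algebra k A] [CoalgebraStruct k A] :
    Prop where
  coassoc : TensorProduct.assoc k A A A ∘ₗ (comul (R := k) (A := A)).rTensor A ∘ₗ comul =
    (comul (R := k) (A := A)).lTensor A ∘ₗ comul
  rTensor_counit_comp_comul : (counit (R := k) (A := A)).rTensor A ∘ₗ comul =
    TensorProduct.mk k k A 1
  lTensor_counit_comp_comul : (counit (R := k) (A := A)).lTensor A ∘ₗ comul =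
    (TensorProduct.mk k A k).flip 1
  counit_one : counit (R := k) (1 : A) = 1
  counit_mul : ∀ a b : A, counit (R := k) (a * b) = counit (R := k) a * counit (R := k) b
  comul_one : comul (R := k) (1 : A) = 1
  comul_mul : ∀ a b : A, comul (R := k) (a * b) = comul (R := k) a * comul (R := k) b

/-- `IsBialgebra` is Mathlib's notion of a bialgebra. -/
abbrev IsBialgebra.toBialgebra {k A : Type*} [Field k] [Ring A] [Algebra k A]
    [C : CoalgebraStruct k A] (h : IsBialgebra k A) : Bialgebra k A :=
  letI : Coalgebra k A :=
    { C with
      coassoc := h.coassoc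
      rTensor_counit_comp_comul := h.rTensor_counit_comp_comul
      lTensor_counit_comp_comul := h.lTensor_counit_comp_comul }
  Bialgebra.mk' k A h.counit_one (fun {a b} => h.counit_mul a b) h.comul_one
    (fun {a b} => h.comul_mul a b)

/-- The linear subspace `D` satisfies `Δ(D) ⊆ D ⊗ D`. -/
def IsSubcoalgebra {k C : Type*} [Field k] [AddCommGroup C] [Module k C] [CoalgebraStruct k C]
    (D : Submodule k C) : Prop :=
  ∀ x ∈ D, comul (R := k) x ∈ LinearMap.range (TensorProduct.map D.subtype D.subtype)

/-- A simple subcoalgebra: nonzero, and without subcoalgebras other than `0` and itself. -/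
def IsSimpleSubcoalgebra {k C : Type*} [Field k] [AddCommGroup C] [Module k C]
    [CoalgebraStruct k C] (D : Submodule k C) : Prop :=
  IsSubcoalgebra D ∧ D ≠ ⊥ ∧ ∀ D' : Submodule k C, IsSubcoalgebra D' → D' ≤ D → D' = ⊥ ∨ D' = D

/-- The coradical: the sum of all simple subcoalgebras. -/
def coradical (k C : Type*) [Field k] [AddCommGroup C] [Module k C] [CoalgebraStruct k C] :
    Submodule k C :=
  sSup {D | IsSimpleSubcoalgebra D}

/-- The set of grouplike elements. -/
def grouplikes (k C : Type*) [Field k] [AddCommGroup C] [Module k C] [CoalgebraStruct k C] :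
    Set C :=
  {c | comul (R := k) c = c ⊗ₜ[k] c ∧ counit (R := k) c = 1}

/-- A coalgebra is pointed if its coradical is spanned by the grouplike elements. -/
def IsPointed (k C : Type*) [Field k] [AddCommGroup C] [Module k C] [CoalgebraStruct k C] :
    Prop :=
  coradical k C = Submodule.span k (grouplikes k C)

/-- A sub-bialgebra: a subalgebra that is a subcoalgebra. -/
def IsSubbialgebra {k A : Type*} [Field k] [Ring A] [Algebra k A] [CoalgebraStruct k A]
    (R : Subalgebra k A) : Prop :=
  IsSubcoalgebra (Subalgebra.toSubmodule R)

/-- The inclusion `R ⊗ R → A ⊗ A`. -/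
def inclTensor {k A : Type*} [Field k] [Ring A] [Algebra k A] (R : Subalgebra k A) :
    (R ⊗[k] R) →ₗ[k] (A ⊗[k] A) :=
  TensorProduct.map R.val.toLinearMap R.val.toLinearMap

theorem inclTensor_injective {k A : Type*} [Field k] [Ring A] [Algebra k A]
    (R : Subalgebra k A) : Function.Injective (inclTensor R) :=
  TensorProduct.map_injective_of_flat_flat _ _ Subtype.val_injective Subtype.val_injective

/-- The comultiplication and counit of `A`, restricted to a sub-bialgebra. -/
abbrev IsSubbialgebra.coalgebraStruct {k A : Type*} [Field k] [Ring A] [Algebra k A]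
    [CoalgebraStruct k A] {R : Subalgebra k A} (hR : IsSubbialgebra R) : CoalgebraStruct k R where
  comul := (LinearEquiv.ofInjective (inclTensor R) (inclTensor_injective R)).symm.toLinearMap ∘ₗ
    (comul (R := k) ∘ₗ R.val.toLinearMap).codRestrict (LinearMap.range (inclTensor R))
      (fun x => hR x.1 x.2)
  counit := counit ∘ₗ R.val.toLinearMap

theorem IsSubbialgebra.inclTensor_comul {k A : Type*} [Field k] [Ring A] [Algebra k A]
    [CoalgebraStruct k A] {R : Subalgebra k A} (hR : IsSubbialgebra R) (x : R) :
    inclTensor R (hR.coalgebraStruct.comul x) = comul (R := k) (x : A) := by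
  have := LinearEquiv.apply_symm_apply
    (LinearEquiv.ofInjective (inclTensor R) (inclTensor_injective R))
    ((comul (R := k) ∘ₗ R.val.toLinearMap).codRestrict (LinearMap.range (inclTensor R))
      (fun x => hR x.1 x.2) x)
  exact congrArg Subtype.val this

/-- Any two elements of the subalgebra commute. -/
def IsCommutativeSubalgebra {k A : Type*} [Field k] [Ring A] [Algebra k A]
    (R : Subalgebra k A) : Prop :=
  ∀ a ∈ R, ∀ b ∈ R, a * b = b * a

/-- `S = R[x; σ, δ]` is an Ore extension of the subring `R`: `δ` is a `σ`-derivation, `x ∉ R`,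
`a x = x σ(a) + δ(a)` for `a ∈ R`, and every element of `S` is uniquely of the form `∑ xⁱ aᵢ`
with finitely many nonzero `aᵢ ∈ R`. -/
structure IsOreExtension {S : Type*} [Ring S] (R : Subring S) (x : S) (σ : R →+* R)
    (δ : R →+ R) : Prop where
  leibniz : ∀ a b : R, δ (a * b) = δ a * σ b + a * δ b
  not_mem : x ∉ R
  mul_x : ∀ a : R, (a : S) * x = x * (σ a : S) + (δ a : S)
  basis : Function.Bijective (fun f : ℕ →₀ R => f.sum fun i a => x ^ i * (a : S))

end General

/-! ### Lyndon words and the Lyndon-Shirshov elements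

The alphabet is `Fin 2`, with `g = 0 < h = 1`; words are lists, ordered lexicographically. -/

/-- Lyndon words. -/
def IsLyndon (w : List (Fin 2)) : Prop :=
  w ≠ [] ∧ ∀ u v : List (Fin 2), u ≠ [] → v ≠ [] → w = u ++ v → w < v ++ u

/-- `(u, v)` is the standard factorization of `w`: both factors are Lyndon, and `v` is of maximal
length. -/
def IsStandardFactorization (w u v : List (Fin 2)) : Prop :=
  w = u ++ v ∧ IsLyndon u ∧ IsLyndon v ∧
    ∀ u' v' : List (Fin 2), w = u' ++ v' → IsLyndon u' → IsLyndon v' → v'.length ≤ v.length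

theorem IsStandardFactorization.length_lt {w u v : List (Fin 2)}
    (h : IsStandardFactorization w u v) : u.length < w.length ∧ v.length < w.length := by
  obtain ⟨rfl, hu, hv, -⟩ := h
  have h1 := List.length_pos_of_ne_nil hu.1
  have h2 := List.length_pos_of_ne_nil hv.1
  simp only [List.length_append]
  omega

theorem IsStandardFactorization.unique {w u v u' v' : List (Fin 2)}
    (h : IsStandardFactorization w u v) (h' : IsStandardFactorization w u' v') :
    u = u' ∧ v = v' := by
  have h1 := h.2.2.2 u' v' h'.1 h'.2.1 h'.2.2.1
  have h2 := h'.2.2.2 u v h.1 h.2.1 h.2.2.1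
  exact List.append_inj' (h.1.symm.trans h'.1) (le_antisymm h2 h1)

/-- The free algebra `k⟨g, h⟩`. -/
abbrev T (k : Type*) [Field k] : Type _ := FreeAlgebra k (Fin 2)

open Classical in
/-- The Lyndon-Shirshov element `E_w`: `E_x = x` for a letter `x`, and `E_w = [E_u, E_v]` if
`(u, v)` is the standard factorization of `w` (the value is `0` at other words). -/
def E (k : Type*) [Field k] (w : List (Fin 2)) : T k :=
  if h : ∃ p : List (Fin 2) × List (Fin 2), IsStandardFactorization w p.1 p.2 then
    E k h.choose.1 * E k h.choose.2 - E k h.choose.2 * E k h.choose.1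
  else
    match w with
    | [x] => FreeAlgebra.ι k x
    | _ => 0
termination_by w.length
decreasing_by
  all_goals first
    | exact h.choose_spec.length_lt.1
    | exact h.choose_spec.length_lt.2

theorem E_letter (k : Type*) [Field k] (x : Fin 2) : E k [x] = FreeAlgebra.ι k x := by
  rw [E, dif_neg]
  rintro ⟨p, hp⟩
  have h1 := hp.length_lt
  have h2 := List.length_pos_of_ne_nil hp.2.1.1
  simp only [List.length_singleton] at h1
  omega

theorem E_of_standardFactorization (k : Type*) [Field k] {w u v : List (Fin 2)}
    (h : IsStandardFactorization w u v) : E k w = E k u * E k v - E k v * E k u := by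
  have hex : ∃ p : List (Fin 2) × List (Fin 2), IsStandardFactorization w p.1 p.2 := ⟨(u, v), h⟩
  obtain ⟨h1, h2⟩ := hex.choose_spec.unique h
  rw [E, dif_pos hex, h1, h2]

/-- The word `ω_n = g h ⋯ h` with `n` letters `h`. -/
def omegaWord (n : ℕ) : List (Fin 2) := 0 :: List.replicate n 1

/-! ### The free bialgebra and its quotient -/

/-- The comultiplication of `k⟨g, h⟩`: `Δ(g) = g ⊗ g` and `Δ(h) = 1 ⊗ h + h ⊗ g`. -/
def comulT (k : Type*) [Field k] : T k →ₐ[k] T k ⊗[k] T k :=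
  FreeAlgebra.lift k ![FreeAlgebra.ι k 0 ⊗ₜ[k] FreeAlgebra.ι k 0,
    1 ⊗ₜ[k] FreeAlgebra.ι k 1 + FreeAlgebra.ι k 1 ⊗ₜ[k] FreeAlgebra.ι k 0]

/-- The counit of `k⟨g, h⟩`: `ε(g) = 1` and `ε(h) = 0`. -/
def counitT (k : Type*) [Field k] : T k →ₐ[k] k :=
  FreeAlgebra.lift k ![1, 0]

/-- The free bialgebra `k⟨g, h⟩`. -/
instance bialgebraT (k : Type*) [Field k] : Bialgebra k (T k) :=
  Bialgebra.ofAlgHom (comulT k) (counitT k)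
    (by
      ext i
      fin_cases i
      · simp [comulT]
      · simp [comulT, TensorProduct.add_tmul, TensorProduct.tmul_add,
          Algebra.TensorProduct.one_def, add_assoc])
    (by
      ext i
      fin_cases i <;> simp [comulT, counitT])
    (by
      ext i
      fin_cases i <;> simp [comulT, counitT])

/-- The quotient of `k⟨g, h⟩` by the two-sided ideal generated by the `E_w`, `w` a Lyndon word
that contains the letter `g` at least twice. -/
abbrev Tbar (k : Type*) [Field k] : Type _ :=
  RingQuot (fun a b : T k => ∃ w : List (Fin 2), IsLyndon w ∧ 2 ≤ w.count 0 ∧ a = E k w ∧ b = 0)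

/-- The projection `k⟨g, h⟩ → T̄`. -/
def proj (k : Type*) [Field k] : T k →ₐ[k] Tbar k := RingQuot.mkAlgHom k _

/-- The image of `h` in `T̄`. -/
def hbar (k : Type*) [Field k] : Tbar k := proj k (FreeAlgebra.ι k 1)

/-- The image of `E_{ω_n}` in `T̄`. -/
def Ebar (k : Type*) [Field k] (n : ℕ) : Tbar k := proj k (E k (omegaWord n))

/-- The subalgebra of `T̄` generated by the images of the `E_{ω_n}`, `n ≥ 0`. -/
def R (k : Type*) [Field k] : Subalgebra k (Tbar k) := Algebra.adjoin k (Set.range (Ebar k))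

/-! ### The Faà di Bruno bialgebra -/

open scoped Nat

/-- The coefficient `n! / (∏ᵢ cᵢ! (i!)^{cᵢ})` of a Bell polynomial. The exponent of the `i`-th
variable, `1 ≤ i ≤ n`, is stored at position `i - 1` of `c`. -/
def bellCoeff (n : ℕ) (c : Fin n → ℕ) : ℕ :=
  n ! / ∏ i : Fin n, (c i)! * ((i : ℕ) + 1)! ^ c i

/-- The division in `bellCoeff` is exact. -/
theorem bellCoeff_mul (n : ℕ) (c : Fin n → ℕ) (hc : ∑ i : Fin n, ((i : ℕ) + 1) * c i = n) :
    bellCoeff n c * ∏ i : Fin n, (c i)! * ((i : ℕ) + 1)! ^ c i = n ! := by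
  apply Nat.div_mul_cancel
  have h1 : ∏ i : Fin n, (c i)! * ((i : ℕ) + 1)! ^ c i ∣ ∏ i : Fin n, (((i : ℕ) + 1) * c i)! := by
    refine Finset.prod_dvd_prod_of_dvd _ _ fun i _ => ⟨Nat.uniformBell (c i) ((i : ℕ) + 1), ?_⟩
    rw [mul_comm ((i : ℕ) + 1), ← Nat.uniformBell_mul_eq (c i) (Nat.succ_ne_zero (i : ℕ))]
    simp only [Nat.succ_eq_add_one]
    ring
  have h2 := h1.trans (Nat.prod_factorial_dvd_factorial_sum Finset.univ
    fun i : Fin n => ((i : ℕ) + 1) * c i)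
  rwa [hc] at h2

/-- The partial Bell polynomial `B_{n,j}`, evaluated at the sequence `x₁, x₂, …`. -/
def bell {A : Type*} [CommRing A] (n j : ℕ) (x : ℕ+ → A) : A :=
  ∑ c ∈ (Finset.univ : Finset (Fin n)).piAntidiag j with ∑ i : Fin n, ((i : ℕ) + 1) * c i = n,
    (bellCoeff n c : A) * ∏ i : Fin n, x (Nat.succPNat i) ^ c i

/-- The polynomial algebra `k[u₁, u₂, …]`. -/
def BFdB (k : Type*) [Field k] : Type _ := MvPolynomial ℕ+ k

instance (k : Type*) [Field k] : CommRing (BFdB k) := inferInstanceAs (CommRing (MvPolynomial ℕ+ k))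

instance (k : Type*) [Field k] : Algebra k (BFdB k) :=
  inferInstanceAs (Algebra k (MvPolynomial ℕ+ k))

/-- The variable `u_n`. -/
def u (k : Type*) [Field k] (n : ℕ+) : BFdB k := (MvPolynomial.X n : MvPolynomial ℕ+ k)

/-- The comultiplication `Δ(u_n) = ∑_{j=1}^{n} u_j ⊗ B_{n,j}(u₁, u₂, …)`. -/
def comulBFdB (k : Type*) [Field k] : BFdB k →ₐ[k] BFdB k ⊗[k] BFdB k :=
  (MvPolynomial.aeval fun n : ℕ+ => ∑ j ∈ Finset.Icc 1 n, u k j ⊗ₜ[k] bell (n : ℕ) (j : ℕ) (u k) :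
    MvPolynomial ℕ+ k →ₐ[k] BFdB k ⊗[k] BFdB k)

/-- The counit `ε(u_n) = δ_{n,1}`. -/
def counitBFdB (k : Type*) [Field k] : BFdB k →ₐ[k] k :=
  (MvPolynomial.aeval fun n : ℕ+ => if n = 1 then (1 : k) else 0 : MvPolynomial ℕ+ k →ₐ[k] k)

theorem comulBFdB_u (k : Type*) [Field k] (n : ℕ+) :
    comulBFdB k (u k n) = ∑ j ∈ Finset.Icc 1 n, u k j ⊗ₜ[k] bell (n : ℕ) (j : ℕ) (u k) :=
  MvPolynomial.aeval_X (S₁ := BFdB k ⊗[k] BFdB k) _ n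

theorem counitBFdB_u (k : Type*) [Field k] (n : ℕ+) :
    counitBFdB k (u k n) = if n = 1 then 1 else 0 :=
  MvPolynomial.aeval_X (S₁ := k) _ n

/-- The comultiplication and counit of the Faà di Bruno bialgebra. -/
instance (k : Type*) [Field k] : CoalgebraStruct k (BFdB k) where
  comul := (comulBFdB k).toLinearMap
  counit := (counitBFdB k).toLinearMap

end FaaDiBrunoOre

end

noncomputable section

namespace FaaDiBrunoOre

/-! ### Lyndon words and the relations of the quotient -/

/-! The Lyndon words without `g` reduce to `h`, those with one `g` are the ω_n = gh^n, and
E_{ω_{n+1}} = [E_{ω_n}, h]. For a < b the word ω_a ω_b is Lyndon with standard factorization (ω_a,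
ω_b), so its relation says that E_{ω_a} and E_{ω_b} commute. Conversely, once all E_{ω_n} commute,
induction along standard factorizations kills every E_w with at least two `g`. Hence T̄ is universal
for pairs g, h whose iterated commutators [g, h, …, h] commute (`commute_Ebar`, `map_E_eq_zero`),
and maps out of T̄ are built and compared on g and h.

Taking the commutator with Δ(h) = 1 ⊗ h + h ⊗ g differentiates the second factor by δ : u_n ↦
u_{n+1}, or shifts the first factor while multiplying the second by u_1. This is the Bell recursion
B_{n+1,j+1} = δ B_{n,j+1} + u_1 B_{n,j} (`bell_succ`), so Δ(E_n) is the Faà di Bruno formula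
(`comulTProj_E`). These values commute, and Δ descends to T̄.

For freeness, T̄ acts on series in t over k[u_1, u_2, …]: E_n multiplies by u_{n+1} and h acts as t
− δ. The leading coefficient in t shows that k[u] embeds and that the sums ∑ h^i a_i are unique
(`oreSum_injective`); the next coefficient shows that in characteristic 0 the centralizer of g is R
(`mem_R_of_commute`), whence maximality. The bialgebra laws of the Faà di Bruno algebra are
inherited through the embedding.

For pointedness, filter T̄ by the number of letters h. Slicing Δ(x) by a functional that kills the
h-free part lowers the degree and stays in any subcoalgebra containing x, so every nonzero
subcoalgebra meets k[g], and a further slice extracts a power of g. -/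

theorem isLyndon_singleton (x : Fin 2) : IsLyndon [x] := by
  refine ⟨by simp, fun u v hu hv h => ?_⟩
  have := congrArg List.length h
  have h1 := List.length_pos_of_ne_nil hu
  have h2 := List.length_pos_of_ne_nil hv
  simp at this
  omega

theorem eq_replicate_one_of_count_zero {w : List (Fin 2)} (h : w.count 0 = 0) :
    w = List.replicate w.length 1 := by
  rw [List.eq_replicate_iff]
  refine ⟨rfl, fun b hb => ?_⟩
  have : b ≠ 0 := by
    rintro rfl
    exact (List.count_eq_zero.1 h) hb
  omega

/-- A power of h with at least two letters equals its own rotation, hence is not strictly smaller.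
-/
theorem IsLyndon.eq_one_of_count_zero {w : List (Fin 2)} (hw : IsLyndon w) (h : w.count 0 = 0) :
    w = [1] := by
  rw [eq_replicate_one_of_count_zero h] at hw ⊢
  generalize w.length = n at hw
  match n with
  | 0 => exact absurd rfl hw.1
  | 1 => rfl
  | n + 2 =>
    have := hw.2 [1] (List.replicate (n + 1) 1) (by simp) (by simp) rfl
    rw [← List.replicate_succ'] at this
    exact absurd this (lt_irrefl _)

/-- A Lyndon word that contains `g` starts with `g`. -/
theorem IsLyndon.exists_eq_cons {w : List (Fin 2)} (hw : IsLyndon w) (h : w.count 0 ≠ 0) :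
    ∃ t, w = 0 :: t := by
  obtain ⟨s, t, rfl⟩ := List.append_of_mem (List.count_pos_iff.1 (Nat.pos_of_ne_zero h))
  match s with
  | [] => exact ⟨t, rfl⟩
  | 0 :: s => exact ⟨s ++ 0 :: t, rfl⟩
  | 1 :: s =>
    -- Rotating a word that starts with h so that an occurrence of g comes first makes it smaller.
    have := hw.2 (1 :: s) (0 :: t) (by simp) (by simp) rfl
    simp [List.cons_lt_cons_iff] at this

theorem IsLyndon.eq_omegaWord_of_count_one {w : List (Fin 2)} (hw : IsLyndon w)
    (h : w.count 0 = 1) : ∃ n, w = omegaWord n := by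
  obtain ⟨t, rfl⟩ := hw.exists_eq_cons (by omega)
  rw [List.count_cons_self] at h
  exact ⟨t.length, congrArg _ (eq_replicate_one_of_count_zero (by omega))⟩

theorem count_omegaWord (n : ℕ) : (omegaWord n).count 0 = 1 := by
  simp [omegaWord, List.count_replicate]

/-- All proper rotations start with h. -/
theorem isLyndon_omegaWord (n : ℕ) : IsLyndon (omegaWord n) := by
  refine ⟨by simp [omegaWord], fun u v hu hv h => ?_⟩
  obtain ⟨x, u, rfl⟩ := List.exists_cons_of_ne_nil hu
  obtain ⟨y, v, rfl⟩ := List.exists_cons_of_ne_nil hv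
  rw [omegaWord, List.cons_append, List.cons.injEq] at h
  have hy : y = 1 := List.eq_of_mem_replicate (h.2 ▸ by simp : y ∈ List.replicate n 1)
  subst hy
  simp [omegaWord, List.cons_lt_cons_iff]

theorem isStandardFactorization_omegaWord_succ (n : ℕ) :
    IsStandardFactorization (omegaWord (n + 1)) (omegaWord n) [1] := by
  refine ⟨by simp [omegaWord, List.replicate_succ'], isLyndon_omegaWord n, isLyndon_singleton 1,
    fun u v h hu hv => ?_⟩
  obtain ⟨x, u, rfl⟩ := List.exists_cons_of_ne_nil hu.1
  rw [omegaWord, List.cons_append, List.cons.injEq] at h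
  have hc : v.count 0 = 0 := by
    have := congrArg (List.count 0) h.2
    simp [List.count_replicate] at this
    omega
  simp [hv.eq_one_of_count_zero hc]

/-- Rotations starting with h are larger. The only other one is ω_b ω_a, which first differs after
gh^a, with h in place of g because a < b. -/
theorem isLyndon_omegaWord_append {a b : ℕ} (hab : a < b) :
    IsLyndon (omegaWord a ++ omegaWord b) := by
  refine ⟨by simp [omegaWord], fun u v hu hv h => ?_⟩
  obtain ⟨x, u, rfl⟩ := List.exists_cons_of_ne_nil hu
  obtain ⟨y, v, rfl⟩ := List.exists_cons_of_ne_nil hv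
  obtain rfl | rfl : y = 0 ∨ y = 1 := by omega
  · have hu' : u = List.replicate a 1 ∧ v = List.replicate b 1 := by
      rw [omegaWord, List.cons_append, List.cons_append, List.cons.injEq] at h
      have h2 := h.2
      have hc := congrArg (List.count 0) h2
      simp [count_omegaWord, List.count_replicate] at hc
      have hu0 : u = _ := eq_replicate_one_of_count_zero (by omega)
      have hv0 : v = _ := eq_replicate_one_of_count_zero (by omega)
      rw [hu0, hv0, omegaWord] at h2
      generalize u.length = p at *
      generalize v.length = q at *
      clear hc h
      subst hu0 hv0
      -- The number of h before the first g determines where the word splits.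
      have key : ∀ a p : ℕ, ∀ s t : List (Fin 2), List.replicate a 1 ++ 0 :: s =
          List.replicate p 1 ++ 0 :: t → a = p ∧ s = t := by
        intro a
        induction a with
        | zero =>
          intro p s t h
          cases p with
          | zero => simpa using h
          | succ p => simp [List.replicate_succ] at h
        | succ a ih =>
          intro p s t h
          cases p with
          | zero => simp [List.replicate_succ] at h
          | succ p =>
            simp only [List.replicate_succ, List.cons_append, List.cons.injEq, true_and] at h
            exact ⟨congrArg _ (ih p s t h).1, (ih p s t h).2⟩
      obtain ⟨rfl, h4⟩ := key _ _ _ _ h2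
      exact ⟨rfl, h4.symm⟩
    obtain ⟨rfl, rfl⟩ := hu'
    have hx : x = 0 := by simp [omegaWord] at h; exact h.symm
    subst hx
    obtain ⟨c, rfl⟩ := Nat.exists_eq_add_of_lt hab
    simp only [omegaWord, List.cons_append, List.cons_lt_cons_iff, lt_irrefl, false_or, true_and]
    rw [add_assoc, List.replicate_add, List.append_assoc]
    rw [List.replicate_succ]
    apply List.append_left_lt
    simp [List.cons_lt_cons_iff]
  · simp [omegaWord, List.cons_lt_cons_iff]

/-- A right factor longer than ω_b that is Lyndon and contains g starts with g, so it takes both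
letters g. The left factor would then be h, although the word starts with g. No order between a and
b is needed, since only the factors have to be Lyndon. -/
theorem isStandardFactorization_omegaWord_append (a b : ℕ) :
    IsStandardFactorization (omegaWord a ++ omegaWord b) (omegaWord a) (omegaWord b) := by
  refine ⟨rfl, isLyndon_omegaWord a, isLyndon_omegaWord b, fun u v h hu hv => ?_⟩
  have hlen : (omegaWord b).length = b + 1 := by simp [omegaWord]
  have hc := congrArg (List.count 0) h
  have hu0 : u.count 0 ≠ 0 := by
    intro h0
    rw [hu.eq_one_of_count_zero h0] at h
    simp [omegaWord] at h
  simp only [List.count_append, count_omegaWord] at hc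
  by_cases hv0 : v.count 0 = 0
  · rw [hv.eq_one_of_count_zero hv0, hlen]
    simp
  by_contra! hlt
  obtain ⟨t, ht⟩ : omegaWord b <:+ v :=
    List.suffix_of_suffix_length_le (List.suffix_append (omegaWord a) _) (h ▸ List.suffix_append u v) hlt.le
  obtain ⟨s, rfl⟩ := hv.exists_eq_cons hv0
  match t with
  | [] => simp only [List.nil_append] at ht; rw [ht] at hlt; exact lt_irrefl _ hlt
  | x :: t =>
    rw [List.cons_append, List.cons.injEq] at ht
    have := congrArg (List.count 0) ht.2
    rw [List.count_append, count_omegaWord] at this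
    rw [List.count_cons_self] at hc
    omega

theorem E_omegaWord_zero (k : Type*) [Field k] : E k (omegaWord 0) = FreeAlgebra.ι k 0 :=
  E_letter k 0

theorem E_omegaWord_succ (k : Type*) [Field k] (n : ℕ) : E k (omegaWord (n + 1)) =
    E k (omegaWord n) * FreeAlgebra.ι k 1 - FreeAlgebra.ι k 1 * E k (omegaWord n) := by
  rw [E_of_standardFactorization k (isStandardFactorization_omegaWord_succ n), E_letter]

/-- An algebra map under which the `E_{ω_n}` commute annihilates `E_w` for every Lyndon word `w`
that contains `g` at least twice. -/
theorem map_E_eq_zero {k B : Type*} [Field k] [Semiring B] [Algebra k B] (φ : T k →ₐ[k] B)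
    (hφ : ∀ m n, Commute (φ (E k (omegaWord m))) (φ (E k (omegaWord n)))) :
    ∀ w : List (Fin 2), 2 ≤ w.count 0 → φ (E k w) = 0 := by
  intro w
  induction hl : w.length using Nat.strong_induction_on generalizing w with
  | _ l ih =>
    subst hl
    intro hw
    by_cases hf : ∃ p : List (Fin 2) × List (Fin 2), IsStandardFactorization w p.1 p.2
    · obtain ⟨⟨s, t⟩, hst⟩ := hf
      have hlen := hst.length_lt
      rw [E_of_standardFactorization k hst]
      -- The target is only a semiring, so the difference is cancelled in the free algebra.
      suffices h : φ (E k s * E k t) = φ (E k t * E k s) by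
        rw [sub_eq_add_neg, map_add, h, ← map_add, add_neg_cancel, map_zero]
      rw [map_mul, map_mul]
      by_cases hs : 2 ≤ s.count 0
      · simp [ih _ hlen.1 s rfl hs]
      by_cases ht : 2 ≤ t.count 0
      · simp [ih _ hlen.2 t rfl ht]
      -- Neither factor has two letters g, so each has exactly one and is some ω_n.
      obtain ⟨rfl, hs', ht', -⟩ := hst
      rw [List.count_append] at hw
      obtain ⟨m, rfl⟩ := hs'.eq_omegaWord_of_count_one (by simp only at *; omega)
      obtain ⟨n, rfl⟩ := ht'.eq_omegaWord_of_count_one (by simp only at *; omega)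
      exact hφ m n
    · rw [E, dif_neg hf]
      split
      · rw [List.count_singleton] at hw
        split at hw <;> omega
      · exact map_zero _

theorem Ebar_zero (k : Type*) [Field k] : Ebar k 0 = proj k (FreeAlgebra.ι k 0) := by
  rw [Ebar, E_omegaWord_zero]

theorem Ebar_succ (k : Type*) [Field k] (n : ℕ) :
    Ebar k (n + 1) = Ebar k n * hbar k - hbar k * Ebar k n := by
  simp only [Ebar, hbar, E_omegaWord_succ, map_sub, map_mul]

theorem commute_Ebar (k : Type*) [Field k] (m n : ℕ) : Commute (Ebar k m) (Ebar k n) := by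
  wlog h : m < n generalizing m n
  · obtain h | rfl := (not_lt.1 h).lt_or_eq
    · exact (this _ _ h).symm
    · exact Commute.refl _
  have h1 : proj k (E k (omegaWord m ++ omegaWord n)) = 0 := by
    rw [← map_zero (proj k)]
    exact RingQuot.mkAlgHom_rel k ⟨_, isLyndon_omegaWord_append h,
      by simp [count_omegaWord], rfl, rfl⟩
  rw [E_of_standardFactorization k (isStandardFactorization_omegaWord_append m n), map_sub, map_mul,
    map_mul] at h1
  exact sub_eq_zero.1 h1

/-- The universal property of `T̄`. -/
def liftTbar {k B : Type*} [Field k] [Semiring B] [Algebra k B] (φ : T k →ₐ[k] B)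
    (hφ : ∀ m n, Commute (φ (E k (omegaWord m))) (φ (E k (omegaWord n)))) : Tbar k →ₐ[k] B :=
  RingQuot.liftAlgHom k ⟨φ, by
    rintro _ _ ⟨w, -, hw, rfl, rfl⟩
    rw [map_E_eq_zero φ hφ w hw, map_zero]⟩

theorem liftTbar_proj {k B : Type*} [Field k] [Semiring B] [Algebra k B] (φ : T k →ₐ[k] B)
    (hφ : ∀ m n, Commute (φ (E k (omegaWord m))) (φ (E k (omegaWord n)))) (x : T k) :
    liftTbar φ hφ (proj k x) = φ x :=
  RingQuot.liftAlgHom_mkAlgHom_apply k φ _ x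

theorem proj_surjective (k : Type*) [Field k] : Function.Surjective (proj k) :=
  RingQuot.mkAlgHom_surjective k _

theorem algHom_Tbar_ext {k B : Type*} [Field k] [Semiring B] [Algebra k B] {f f' : Tbar k →ₐ[k] B}
    (hg : f (Ebar k 0) = f' (Ebar k 0)) (hh : f (hbar k) = f' (hbar k)) : f = f' := by
  apply RingQuot.ringQuot_ext'
  ext i
  rw [Ebar_zero] at hg
  fin_cases i
  · exact hg
  · exact hh

/-- A subspace of `T̄` that contains `1` and is stable under right multiplication by `g` and `h` is
the whole space. -/
theorem mem_of_mul_mem {k : Type*} [Field k] (N : Submodule k (Tbar k)) (h1 : 1 ∈ N)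
    (hg : ∀ x ∈ N, x * Ebar k 0 ∈ N) (hh : ∀ x ∈ N, x * hbar k ∈ N) (x : Tbar k) : x ∈ N := by
  obtain ⟨x, rfl⟩ := proj_surjective k x
  -- Quantifying over y makes the statement multiplicative in x.
  suffices ∀ y ∈ N, y * proj k x ∈ N by simpa using this 1 h1
  induction x using FreeAlgebra.induction with
  | grade0 r =>
    intro y hy
    rw [AlgHom.commutes, ← Algebra.commutes, ← Algebra.smul_def]
    exact N.smul_mem r hy
  | grade1 i =>
    intro y hy
    fin_cases i
    · exact Ebar_zero k ▸ hg y hy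
    · exact hh y hy
  | mul a b ha hb =>
    intro y hy
    rw [map_mul, ← mul_assoc]
    exact hb _ (ha _ hy)
  | add a b ha hb =>
    intro y hy
    rw [map_add, mul_add]
    exact N.add_mem (ha _ hy) (hb _ hy)

/-! ### The recursion of the Bell polynomials -/

section Bell

open scoped Nat

theorem map_bell {A B : Type*} [CommRing A] [CommRing B] (f : A →+* B) (n j : ℕ) (x : ℕ+ → A) :
    f (bell n j x) = bell n j (fun i => f (x i)) := by
  simp [bell]

theorem bell_zero_right {A : Type*} [CommRing A] {n : ℕ} (hn : n ≠ 0) (x : ℕ+ → A) :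
    bell n 0 x = 0 := by
  rw [bell, Finset.filter_eq_empty_iff.2, Finset.sum_empty]
  intro c hc
  rw [Finset.mem_piAntidiag] at hc
  have : ∀ i, c i = 0 := by simpa using hc.1
  simpa [this] using hn.symm

theorem bell_eq_zero_of_lt {A : Type*} [CommRing A] {n j : ℕ} (h : n < j) (x : ℕ+ → A) :
    bell n j x = 0 := by
  rw [bell, Finset.filter_eq_empty_iff.2, Finset.sum_empty]
  intro c hc hc'
  rw [Finset.mem_piAntidiag] at hc
  have : ∑ i, c i ≤ ∑ i : Fin n, ((i : ℕ) + 1) * c i :=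
    Finset.sum_le_sum fun i _ => Nat.le_mul_of_pos_left _ (Nat.succ_pos _)
  exact absurd (hc.1.symm.trans_le (this.trans_eq hc')) (not_le.2 h)

section GeneratingFunction

open PowerSeries

variable {A : Type*} [CommRing A] [Algebra ℚ A]

/-- The exponential generating function `∑_{i ≥ 1} x_i t^i / i!`. -/
def egf (x : ℕ+ → A) : A⟦X⟧ :=
  PowerSeries.mk fun i => if h : 0 < i then ((i ! : ℚ)⁻¹) • x ⟨i, h⟩ else 0

theorem coeff_egf_succ (x : ℕ+ → A) (i : ℕ) :
    coeff (i + 1) (egf x) = (((i + 1)! : ℚ)⁻¹) • x i.succPNat := by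
  rw [egf, coeff_mk, dif_pos i.succ_pos]
  rfl

/-- The partial Bell polynomials are the coefficients of the powers of the exponential generating
function. -/
theorem factorial_smul_bell (n j : ℕ) (x : ℕ+ → A) :
    (j ! : ℚ) • bell n j x = (n ! : ℚ) • coeff n (egf x ^ j) := by
  -- The truncation of the series at degree n is a finite sum, to which the multinomial theorem
  -- applies; coefficients up to t^n do not change.
  set G : A⟦X⟧ := ∑ i : Fin n, C ((((i : ℕ) + 1)! : ℚ)⁻¹ • x (Nat.succPNat i)) * X ^ ((i : ℕ) + 1)
    with hG
  have h1 : (X : A⟦X⟧) ^ (n + 1) ∣ egf x - G := by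
    rw [X_pow_dvd_iff]
    intro m hm
    rw [map_sub, sub_eq_zero, hG, map_sum]
    simp only [coeff_C_mul, coeff_X_pow, mul_ite, mul_one, mul_zero]
    cases m with
    | zero => simp [egf]
    | succ m =>
      rw [coeff_egf_succ, Finset.sum_eq_single (⟨m, by omega⟩ : Fin n)]
      · simp
      · intro b _ hb
        rw [if_neg]
        intro h
        apply hb
        ext
        simp only
        omega
      · simp
  have h2 : coeff n (egf x ^ j) = coeff n (G ^ j) := by
    have := X_pow_dvd_iff.1 (h1.trans (sub_dvd_pow_sub_pow (egf x) G j)) n n.lt_succ_self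
    rwa [map_sub, sub_eq_zero] at this
  rw [h2, hG, Finset.sum_pow_eq_sum_piAntidiag, map_sum, bell, Finset.smul_sum, Finset.smul_sum,
    Finset.sum_filter]
  refine Finset.sum_congr rfl fun c hc => ?_
  rw [Finset.mem_piAntidiag] at hc
  have h3 : ∏ i : Fin n, (C ((((i : ℕ) + 1)! : ℚ)⁻¹ • x (Nat.succPNat i)) *
      (X : A⟦X⟧) ^ ((i : ℕ) + 1)) ^ c i =
      C (((∏ i : Fin n, ((((i : ℕ) + 1)! : ℚ) ^ c i))⁻¹) • ∏ i : Fin n, x (Nat.succPNat i) ^ c i) *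
        X ^ (∑ i : Fin n, ((i : ℕ) + 1) * c i) := by
    simp only [mul_pow, Finset.prod_mul_distrib, ← pow_mul, Finset.prod_pow_eq_pow_sum,
      ← map_pow, ← map_prod, smul_pow, Finset.prod_smul, inv_pow, Finset.prod_inv_distrib]
  rw [h3, ← map_natCast (C (R := A)), ← mul_assoc, ← map_mul, coeff_C_mul, coeff_X_pow]
  split_ifs with h4 h5 h5
  · have h6 := bellCoeff_mul n c h4
    have h7 := Nat.multinomial_spec Finset.univ c
    rw [hc.1] at h7
    rw [Finset.prod_mul_distrib] at h6
    rw [mul_one, ← nsmul_eq_mul, ← nsmul_eq_mul, ← Nat.cast_smul_eq_nsmul ℚ,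
      ← Nat.cast_smul_eq_nsmul ℚ, smul_smul, smul_smul, smul_smul]
    congr 1
    rw [← h6, ← h7]
    push_cast
    have : (∏ i : Fin n, ((((i : ℕ) + 1)! : ℚ) ^ c i)) ≠ 0 :=
      Finset.prod_ne_zero_iff.2 fun i _ => pow_ne_zero _ (by positivity)
    field_simp
  · exact absurd h4.symm h5
  · exact absurd h5.symm h4
  · simp

/-- A derivation, applied to the coefficients of a power series. -/
def mapDerivation (d : Derivation ℚ A A) : Derivation ℚ A⟦X⟧ A⟦X⟧ :=
  Derivation.mk' { toFun := fun f => PowerSeries.mk fun n => d (coeff n f)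
                   map_add' := fun f g => by ext; simp
                   map_smul' := fun r f => by ext; simp } (fun f g => by
    ext n
    simp only [LinearMap.coe_mk, AddHom.coe_mk, coeff_mk, map_add, smul_eq_mul, coeff_mul,
      map_sum, Derivation.leibniz, Finset.sum_add_distrib]
    congr 1
    rw [← Finset.Nat.sum_antidiagonal_swap]
    rfl)

theorem coeff_mapDerivation (d : Derivation ℚ A A) (f : A⟦X⟧) (n : ℕ) :
    coeff n (mapDerivation d f) = d (coeff n f) :=
  coeff_mk n (fun n => d (coeff n f))

/-- The series F = ∑ x_i t^i / i! satisfies F' = x_1 + dF, hence d(F^{j+1}) = (F^{j+1})' − (j+1) x_1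
F^j. The recursion is the coefficient of t^n. -/
theorem bell_succ_of_rat (d : Derivation ℚ A A) (x : ℕ+ → A) (hx : ∀ n, d (x n) = x (n + 1))
    (n j : ℕ) : bell (n + 1) (j + 1) x = d (bell n (j + 1) x) + x 1 * bell n j x := by
  have h0 : derivative A (egf x) = C (x 1) + mapDerivation d (egf x) := by
    ext m
    rw [coeff_derivative, map_add, coeff_mapDerivation, coeff_egf_succ]
    cases m with
    | zero => simp [egf]; rfl
    | succ m =>
      rw [coeff_egf_succ, coeff_C, if_neg (by simp), zero_add, d.map_smul, hx,
        show m.succPNat + 1 = (m + 1).succPNat from rfl, Nat.factorial_succ (m + 1)]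
      have : (((m + 1 : ℕ) : A) + 1) = algebraMap ℚ A (m + 1 + 1) := by simp
      rw [this, mul_comm, ← Algebra.smul_def, smul_smul]
      congr 1
      push_cast
      field_simp
  have h1 : mapDerivation d (egf x ^ (j + 1)) = derivative A (egf x ^ (j + 1)) -
      C (x 1) * (((j + 1 : ℕ) : A⟦X⟧) * egf x ^ j) := by
    rw [Derivation.leibniz_pow, Derivation.leibniz_pow, h0]
    simp only [smul_eq_mul, nsmul_eq_mul, Nat.add_sub_cancel]
    ring
  have h2 := congrArg (coeff n) h1
  rw [coeff_mapDerivation, map_sub, coeff_derivative, coeff_C_mul,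
    ← nsmul_eq_mul, map_nsmul, nsmul_eq_mul] at h2
  have hj : ((j + 1)! : ℚ) ≠ 0 := by positivity
  have e1 := factorial_smul_bell (n + 1) (j + 1) x
  have e2 := factorial_smul_bell n (j + 1) x
  have e3 := factorial_smul_bell n j x
  have e2' := congrArg d e2
  rw [d.map_smul, d.map_smul, h2] at e2'
  apply (smul_right_injective A hj)
  simp only [smul_add]
  rw [e1, e2', Nat.factorial_succ n, Nat.factorial_succ j]
  have : (((j + 1) * j ! : ℕ) : ℚ) • (x 1 * bell n j x) =
      ((j + 1 : ℕ) : A) * x 1 * ((n ! : ℚ) • coeff n (egf x ^ j)) := by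
    rw [← e3]
    simp only [Algebra.smul_def, Nat.cast_mul, map_mul, map_natCast]
    ring
  rw [this]
  simp only [Algebra.smul_def, Nat.cast_mul, map_mul, map_natCast]
  push_cast
  ring

end GeneratingFunction

/-- The derivation of `ℤ[u₁, u₂, …]` with `u_n ↦ u_{n+1}` and the derivation `d` with
`x_n ↦ x_{n+1}` are intertwined by evaluation at `x`. -/
theorem eval₂Hom_mkDerivation {A : Type*} [CommRing A] (d : Derivation ℤ A A) (x : ℕ+ → A)
    (hx : ∀ n, d (x n) = x (n + 1)) (p : MvPolynomial ℕ+ ℤ) :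
    MvPolynomial.eval₂Hom (Int.castRingHom A) x (MvPolynomial.mkDerivation ℤ
      (fun n => (MvPolynomial.X (n + 1) : MvPolynomial ℕ+ ℤ)) p) =
      d (MvPolynomial.eval₂Hom (Int.castRingHom A) x p) := by
  induction p using MvPolynomial.induction_on with
  | C r => simp
  | add p q hp hq => rw [map_add, map_add, hp, hq, map_add, map_add]
  | mul_X p n hp =>
    simp only [Derivation.leibniz, MvPolynomial.mkDerivation_X, smul_eq_mul, map_add, map_mul, hp,
      MvPolynomial.eval₂Hom_X', hx]

/-- The recursion of the partial Bell polynomials. -/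
theorem bell_succ {A : Type*} [CommRing A] (d : Derivation ℤ A A) (x : ℕ+ → A)
    (hx : ∀ n, d (x n) = x (n + 1)) (n j : ℕ) :
    bell (n + 1) (j + 1) x = d (bell n (j + 1) x) + x 1 * bell n j x := by
  -- The identity is universal: it is proved over ℤ inside ℚ[X_1, X_2, …], where factorials are
  -- invertible, and then specialized to any characteristic.
  have hZ : bell (n + 1) (j + 1) (MvPolynomial.X : ℕ+ → MvPolynomial ℕ+ ℤ) =
      MvPolynomial.mkDerivation ℤ (fun n => (MvPolynomial.X (n + 1) : MvPolynomial ℕ+ ℤ))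
        (bell n (j + 1) MvPolynomial.X) + MvPolynomial.X 1 * bell n j MvPolynomial.X := by
    set D := MvPolynomial.mkDerivation ℚ (fun n => (MvPolynomial.X (n + 1) : MvPolynomial ℕ+ ℚ))
    have hD : ∀ n, D (MvPolynomial.X n) = MvPolynomial.X (n + 1) := fun n => by simp [D]
    have hinj : Function.Injective (MvPolynomial.eval₂Hom (Int.castRingHom _)
        (MvPolynomial.X : ℕ+ → MvPolynomial ℕ+ ℚ)) := by
      have h1 : MvPolynomial.eval₂Hom (Int.castRingHom _)
          (MvPolynomial.X : ℕ+ → MvPolynomial ℕ+ ℚ) = MvPolynomial.map (Int.castRingHom ℚ) := by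
        ext <;> simp
      rw [h1]
      exact MvPolynomial.map_injective (Int.castRingHom ℚ) Int.cast_injective
    apply hinj
    rw [map_add, map_mul, eval₂Hom_mkDerivation (D.restrictScalars ℤ) _ hD, map_bell, map_bell,
      map_bell]
    simp only [MvPolynomial.eval₂Hom_X']
    exact bell_succ_of_rat D _ hD n j
  have h := congrArg (MvPolynomial.eval₂Hom (Int.castRingHom A) x) hZ
  rw [map_add, map_mul, eval₂Hom_mkDerivation d _ hx, map_bell, map_bell, map_bell] at h
  simpa only [MvPolynomial.eval₂Hom_X'] using h

end Bell

/-! ### The algebra of the Faà di Bruno bialgebra -/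

instance (k : Type*) [Field k] : IsDomain (BFdB k) :=
  inferInstanceAs (IsDomain (MvPolynomial ℕ+ k))

theorem u_ne_zero (k : Type*) [Field k] (n : ℕ+) : u k n ≠ 0 :=
  MvPolynomial.X_ne_zero (R := k) n

theorem BFdB.algHom_ext {k B : Type*} [Field k] [Semiring B] [Algebra k B] {f f' : BFdB k →ₐ[k] B}
    (h : ∀ n, f (u k n) = f' (u k n)) : f = f' :=
  MvPolynomial.algHom_ext (R := k) (σ := ℕ+) h

theorem BFdB.induction_on {k : Type*} [Field k] {motive : BFdB k → Prop} (p : BFdB k)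
    (algebraMap : ∀ r, motive (algebraMap k (BFdB k) r))
    (add : ∀ p q, motive p → motive q → motive (p + q))
    (mul_u : ∀ p n, motive p → motive (p * u k n)) : motive p :=
  MvPolynomial.induction_on (R := k) (σ := ℕ+) p algebraMap add mul_u

/-- The derivation `X_n ↦ X_{n+1}` of the polynomial algebra. -/
def mvShiftDer (k : Type*) [Field k] : Derivation k (MvPolynomial ℕ+ k) (MvPolynomial ℕ+ k) :=
  MvPolynomial.mkDerivation k fun n => MvPolynomial.X (n + 1)

/-- The derivation `u_n ↦ u_{n+1}` of the algebra of the Faà di Bruno bialgebra. -/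
def shiftDer (k : Type*) [Field k] : Derivation k (BFdB k) (BFdB k) :=
  mvShiftDer k

theorem shiftDer_u (k : Type*) [Field k] (n : ℕ+) : shiftDer k (u k n) = u k (n + 1) :=
  MvPolynomial.mkDerivation_X (R := k) (A := MvPolynomial ℕ+ k) _ n

theorem bell_succ_u (k : Type*) [Field k] (n j : ℕ) : bell (n + 1) (j + 1) (u k) =
    shiftDer k (bell n (j + 1) (u k)) + u k 1 * bell n j (u k) :=
  bell_succ ((shiftDer k).restrictScalars ℤ) (u k) (shiftDer_u k) n j

/-! ### The commutative subalgebra `R` -/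

theorem isCommutativeSubalgebra_R (k : Type*) [Field k] : IsCommutativeSubalgebra (R k) := by
  have : IsMulCommutative (R k) := Algebra.isMulCommutative_adjoin k (by
    rintro _ ⟨m, rfl⟩ _ ⟨n, rfl⟩
    exact commute_Ebar k m n)
  exact fun a ha b hb => congrArg Subtype.val (mul_comm' (⟨a, ha⟩ : R k) ⟨b, hb⟩)

/-- The commutative ring structure of `R`. -/
abbrev commRingR (k : Type*) [Field k] : CommRing (R k) :=
  { (R k).toRing with
    mul_comm := fun a b => Subtype.ext (isCommutativeSubalgebra_R k a a.2 b b.2) }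

theorem Ebar_mem_R (k : Type*) [Field k] (n : ℕ) : Ebar k n ∈ R k :=
  Algebra.subset_adjoin ⟨n, rfl⟩

/-- The algebra map `u_{n+1} ↦ E_n`. -/
def toR (k : Type*) [Field k] : BFdB k →ₐ[k] R k :=
  letI := commRingR k
  (MvPolynomial.aeval fun n : ℕ+ => (⟨Ebar k n.natPred, Ebar_mem_R k _⟩ : R k) :
    MvPolynomial ℕ+ k →ₐ[k] R k)

/-- The algebra map `u_{n+1} ↦ E_n`, with values in `T̄`. -/
def toTbar (k : Type*) [Field k] : BFdB k →ₐ[k] Tbar k :=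
  (R k).val.comp (toR k)

theorem toTbar_u (k : Type*) [Field k] (n : ℕ+) : toTbar k (u k n) = Ebar k n.natPred := by
  let _ := commRingR k
  exact congrArg Subtype.val (MvPolynomial.aeval_X (R := k) (S₁ := R k)
    (fun n : ℕ+ => (⟨Ebar k n.natPred, Ebar_mem_R k _⟩ : R k)) n)

theorem toTbar_u_succPNat (k : Type*) [Field k] (n : ℕ) :
    toTbar k (u k n.succPNat) = Ebar k n := by
  rw [toTbar_u, Nat.natPred_succPNat]

theorem toTbar_u_one (k : Type*) [Field k] : toTbar k (u k 1) = Ebar k 0 :=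
  toTbar_u_succPNat k 0

theorem toR_surjective (k : Type*) [Field k] : Function.Surjective (toR k) := by
  have h : R k ≤ (toTbar k).range := by
    refine Algebra.adjoin_le ?_
    rintro _ ⟨n, rfl⟩
    exact ⟨_, toTbar_u_succPNat k n⟩
  intro x
  obtain ⟨a, ha⟩ := h x.2
  exact ⟨a, Subtype.ext ha⟩

theorem toTbar_mem_R (k : Type*) [Field k] (a : BFdB k) : toTbar k a ∈ R k :=
  (toR k a).2

theorem commute_toTbar (k : Type*) [Field k] (a b : BFdB k) :
    Commute (toTbar k a) (toTbar k b) := by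
  rw [Commute, SemiconjBy, ← map_mul, mul_comm, map_mul]

/-- Commutation with h and δ are both derivations, and they agree on the generators. -/
theorem toTbar_mul_hbar {k : Type*} [Field k] (a : BFdB k) :
    toTbar k a * hbar k = hbar k * toTbar k a + toTbar k (shiftDer k a) := by
  induction a using BFdB.induction_on with
  | algebraMap r =>
    rw [Derivation.map_algebraMap, map_zero, add_zero, AlgHom.commutes, Algebra.commutes]
  | add p q hp hq => rw [map_add, map_add, map_add, add_mul, mul_add, hp, hq]; abel
  | mul_u p n hp =>
    have hn : toTbar k (u k n) * hbar k =
        hbar k * toTbar k (u k n) + toTbar k (u k (n + 1)) := by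
      have h1 : toTbar k (u k (n + 1)) = Ebar k (n.natPred + 1) := by
        rw [← toTbar_u_succPNat]
        congr 2
        exact PNat.eq (by simp)
      rw [h1, Ebar_succ, toTbar_u]
      abel
    rw [Derivation.leibniz, shiftDer_u, smul_eq_mul, smul_eq_mul, map_mul, map_add, map_mul,
      map_mul, mul_assoc, hn, mul_add, ← mul_assoc, hp, (commute_toTbar k (u k n) _).eq]
    noncomm_ring

/-! ### The bialgebra structure -/

/-- The comultiplication of `k⟨g, h⟩`, with values in `T̄ ⊗ T̄`. -/
def comulTProj (k : Type*) [Field k] : T k →ₐ[k] Tbar k ⊗[k] Tbar k :=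
  (Algebra.TensorProduct.map (proj k) (proj k)).comp (comulT k)

theorem comulTProj_g (k : Type*) [Field k] :
    comulTProj k (FreeAlgebra.ι k 0) = Ebar k 0 ⊗ₜ Ebar k 0 := by
  simp [comulTProj, comulT, Ebar_zero]

theorem comulTProj_h (k : Type*) [Field k] :
    comulTProj k (FreeAlgebra.ι k 1) = 1 ⊗ₜ hbar k + hbar k ⊗ₜ Ebar k 0 := by
  simp [comulTProj, comulT, Ebar_zero, hbar]

/-- The summand 1 ⊗ h of Δ(h) yields the δ-term, and h ⊗ g yields the shifted term with factor u_1.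
-/
theorem toTbar_tmul_mul_comulTProj_h {k : Type*} [Field k] (n : ℕ) (b : BFdB k) :
    (Ebar k n ⊗ₜ[k] toTbar k b) * comulTProj k (FreeAlgebra.ι k 1) =
      comulTProj k (FreeAlgebra.ι k 1) * (Ebar k n ⊗ₜ[k] toTbar k b) +
    (Ebar k n ⊗ₜ toTbar k (shiftDer k b) + Ebar k (n + 1) ⊗ₜ toTbar k (u k 1 * b)) := by
  rw [comulTProj_h, mul_add, add_mul]
  simp only [Algebra.TensorProduct.tmul_mul_tmul, mul_one, one_mul]
  rw [toTbar_mul_hbar, ← toTbar_u_one, (commute_toTbar k b _).eq, map_mul, TensorProduct.tmul_add,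
    show Ebar k n * hbar k = hbar k * Ebar k n + Ebar k (n + 1) by rw [Ebar_succ]; abel,
    TensorProduct.add_tmul]
  abel

theorem comulTProj_E (k : Type*) [Field k] (n : ℕ) : comulTProj k (E k (omegaWord n)) =
    ∑ i ∈ Finset.range (n + 1), Ebar k i ⊗ₜ[k] toTbar k (bell (n + 1) (i + 1) (u k)) := by
  induction n with
  | zero =>
    have : bell 1 1 (u k) = u k 1 := by
      rw [bell_succ_u k 0 0, bell_eq_zero_of_lt (by omega : 0 < 0 + 1), map_zero, zero_add]
      simp [bell, bellCoeff]
    rw [E_omegaWord_zero, comulTProj_g, zero_add, Finset.sum_range_one, zero_add, this,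
      toTbar_u_one]
  | succ n ih =>
    rw [E_omegaWord_succ, map_sub, map_mul, map_mul, ih]
    refine sub_eq_of_eq_add' ?_
    simp only [Finset.sum_mul, Finset.mul_sum, toTbar_tmul_mul_comulTProj_h,
      Finset.sum_add_distrib]
    refine congrArg _ ?_
    simp only [bell_succ_u k (n + 1), map_add, TensorProduct.tmul_add, Finset.sum_add_distrib]
    congr 1
    -- The extra top term carries B_{n+1,n+2} = 0; in the other sum the extra bottom term carries
    -- B_{n+1,0} = 0.
    · rw [Finset.sum_range_succ _ (n + 1), bell_eq_zero_of_lt (by omega : n + 1 < n + 1 + 1)]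
      simp
    · rw [Finset.sum_range_succ' _ (n + 1), bell_zero_right n.succ_ne_zero]
      simp

/-- This is the condition for Δ to descend to T̄; all tensor factors lie in the commutative algebra
R. -/
theorem commute_comulTProj_E (k : Type*) [Field k] (m n : ℕ) :
    Commute (comulTProj k (E k (omegaWord m))) (comulTProj k (E k (omegaWord n))) := by
  rw [comulTProj_E, comulTProj_E]
  refine Commute.sum_left _ _ _ fun i _ => Commute.sum_right _ _ _ fun j _ => ?_
  rw [Commute, SemiconjBy, Algebra.TensorProduct.tmul_mul_tmul,
    Algebra.TensorProduct.tmul_mul_tmul, (commute_Ebar k i j).eq, (commute_toTbar k _ _).eq]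

/-- The comultiplication of `T̄`. -/
def comulTbar (k : Type*) [Field k] : Tbar k →ₐ[k] Tbar k ⊗[k] Tbar k :=
  liftTbar (comulTProj k) (commute_comulTProj_E k)

/-- The counit of `T̄`. -/
def counitTbar (k : Type*) [Field k] : Tbar k →ₐ[k] k :=
  liftTbar (counitT k) fun _ _ => Commute.all _ _

instance coalgebraStructTbar (k : Type*) [Field k] : CoalgebraStruct k (Tbar k) where
  comul := (comulTbar k).toLinearMap
  counit := (counitTbar k).toLinearMap

theorem comulTbar_g (k : Type*) [Field k] : comulTbar k (Ebar k 0) = Ebar k 0 ⊗ₜ Ebar k 0 := by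
  rw [comulTbar, ← comulTProj_g, Ebar_zero, liftTbar_proj]

theorem comulTbar_h (k : Type*) [Field k] :
    comulTbar k (hbar k) = 1 ⊗ₜ hbar k + hbar k ⊗ₜ Ebar k 0 := by
  rw [comulTbar, hbar, liftTbar_proj, comulTProj_h, hbar]

theorem comulTbar_Ebar (k : Type*) [Field k] (n : ℕ) : comulTbar k (Ebar k n) =
    ∑ i ∈ Finset.range (n + 1), Ebar k i ⊗ₜ[k] toTbar k (bell (n + 1) (i + 1) (u k)) := by
  rw [comulTbar, Ebar, liftTbar_proj, comulTProj_E]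

theorem counitTbar_g (k : Type*) [Field k] : counitTbar k (Ebar k 0) = 1 := by
  rw [counitTbar, Ebar_zero, liftTbar_proj]
  simp [counitT]

theorem counitTbar_h (k : Type*) [Field k] : counitTbar k (hbar k) = 0 := by
  rw [counitTbar, hbar, liftTbar_proj]
  simp [counitT]

theorem counitTbar_Ebar_succ (k : Type*) [Field k] (n : ℕ) :
    counitTbar k (Ebar k (n + 1)) = 0 := by
  rw [Ebar_succ, map_sub, map_mul, map_mul, counitTbar_h, mul_zero, zero_mul, sub_zero]

/-- Each coalgebra law is an equality of algebra maps, so g and h suffice. -/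
theorem isBialgebra_Tbar (k : Type*) [Field k] : IsBialgebra k (Tbar k) where
  coassoc := by
    have h : (Algebra.TensorProduct.assoc k k k (Tbar k) (Tbar k) (Tbar k)).toAlgHom.comp
        ((Algebra.TensorProduct.map (comulTbar k) (AlgHom.id k _)).comp (comulTbar k)) =
        (Algebra.TensorProduct.map (AlgHom.id k _) (comulTbar k)).comp (comulTbar k) := by
      apply algHom_Tbar_ext
      · simp [comulTbar_g]
      · simp [comulTbar_h, comulTbar_g, TensorProduct.add_tmul, TensorProduct.tmul_add,
          Algebra.TensorProduct.one_def, add_assoc]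
    exact congrArg AlgHom.toLinearMap h
  rTensor_counit_comp_comul := by
    have h : (Algebra.TensorProduct.map (counitTbar k) (AlgHom.id k _)).comp (comulTbar k) =
        Algebra.TensorProduct.includeRight := by
      apply algHom_Tbar_ext
      · simp [comulTbar_g, counitTbar_g]
      · simp [comulTbar_h, counitTbar_h]
    exact congrArg AlgHom.toLinearMap h
  lTensor_counit_comp_comul := by
    have h : (Algebra.TensorProduct.map (AlgHom.id k _) (counitTbar k)).comp (comulTbar k) =
        Algebra.TensorProduct.includeLeft := by
      apply algHom_Tbar_ext
      · simp [comulTbar_g, counitTbar_g]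
      · simp [comulTbar_h, counitTbar_g, counitTbar_h]
    exact congrArg AlgHom.toLinearMap h
  counit_one := map_one (counitTbar k)
  counit_mul := map_mul (counitTbar k)
  comul_one := map_one (comulTbar k)
  comul_mul := map_mul (comulTbar k)

/-- The projection, as a morphism of bialgebras. -/
def projBialgHom (k : Type*) [Field k] : T k →ₐc[k] Tbar k :=
  { proj k with
    map_smul' := map_smul (proj k)
    counit_comp := by
      ext x
      exact liftTbar_proj _ _ _
    map_comp_comul := by
      ext x
      exact (liftTbar_proj (comulTProj k) (commute_comulTProj_E k) x).symm }

/-! ### The Faà di Bruno bialgebra inside `T̄` -/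

theorem comulTbar_toTbar {k : Type*} [Field k] (a : BFdB k) : comulTbar k (toTbar k a) =
    Algebra.TensorProduct.map (toTbar k) (toTbar k) (comulBFdB k a) := by
  revert a
  refine AlgHom.congr_fun (φ₁ := (comulTbar k).comp (toTbar k))
    (φ₂ := (Algebra.TensorProduct.map (toTbar k) (toTbar k)).comp (comulBFdB k))
    (BFdB.algHom_ext fun n => ?_)
  obtain ⟨n, rfl⟩ : ∃ m : ℕ, n = m.succPNat := ⟨n.natPred, by simp⟩
  simp only [AlgHom.comp_apply]
  rw [toTbar_u_succPNat, comulTbar_Ebar, comulBFdB_u, map_sum]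
  simp only [Algebra.TensorProduct.map_tmul]
  refine Finset.sum_bij (fun i _ => i.succPNat) ?_ ?_ ?_ ?_
  · intro i hi
    rw [Finset.mem_range] at hi
    rw [Finset.mem_Icc]
    exact ⟨one_le, Nat.succPNat_le_succPNat.2 (by omega)⟩
  · intro i _ j _ h
    exact Nat.succPNat_injective h
  · intro j hj
    rw [Finset.mem_Icc] at hj
    refine ⟨j.natPred, ?_, by simp⟩
    have := PNat.coe_le_coe _ _ |>.2 hj.2
    have h3 := PNat.natPred_add_one j
    rw [Nat.succPNat_coe] at this
    rw [Finset.mem_range]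
    omega
  · intro i _
    rw [toTbar_u_succPNat]
    rfl

theorem counitTbar_toTbar {k : Type*} [Field k] (a : BFdB k) :
    counitTbar k (toTbar k a) = counitBFdB k a := by
  revert a
  refine AlgHom.congr_fun (φ₁ := (counitTbar k).comp (toTbar k)) (BFdB.algHom_ext fun n => ?_)
  obtain ⟨n, rfl⟩ : ∃ m : ℕ, n = m.succPNat := ⟨n.natPred, by simp⟩
  rw [AlgHom.comp_apply, toTbar_u_succPNat, counitBFdB_u]
  cases n with
  | zero => rw [counitTbar_g]; rfl
  | succ n => rw [counitTbar_Ebar_succ, if_neg (by simp [← PNat.coe_eq_one_iff])]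

/-! ### A faithful action of `T̄`

`T̄` acts on the sequences in `k[u₁, u₂, …]`, which are to be thought of as power series in a
variable `t`: the `E_n` act by multiplication and `h` acts as `t - δ`. -/

/-- The action of `h`. -/
def hAction (k : Type*) [Field k] : Module.End k (ℕ → BFdB k) where
  toFun f n := (match n with
    | 0 => 0
    | m + 1 => f m) - shiftDer k (f n)
  map_add' f f' := by
    funext n
    cases n <;> simp only [Pi.add_apply, map_add] <;> abel
  map_smul' r f := by
    funext n
    cases n <;> simp [smul_sub]

theorem hAction_zero {k : Type*} [Field k] (f : ℕ → BFdB k) :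
    hAction k f 0 = - shiftDer k (f 0) :=
  zero_sub _

theorem hAction_succ {k : Type*} [Field k] (f : ℕ → BFdB k) (n : ℕ) :
    hAction k f (n + 1) = f n - shiftDer k (f (n + 1)) :=
  rfl

/-- Multiplication by a commutes with the shift t, so only −δ contributes, through the Leibniz rule.
-/
theorem lsmul_mul_hAction {k : Type*} [Field k] (a : BFdB k) :
    Algebra.lsmul k k (ℕ → BFdB k) a * hAction k - hAction k * Algebra.lsmul k k _ a =
      Algebra.lsmul k k _ (shiftDer k a) := by
  refine LinearMap.ext fun f => funext fun n => ?_
  cases n with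
  | zero =>
    simp only [LinearMap.sub_apply, Module.End.mul_apply, Algebra.lsmul_coe, Pi.sub_apply,
      Pi.smul_apply, hAction_zero, Derivation.leibniz, smul_eq_mul]
    ring
  | succ n =>
    simp only [LinearMap.sub_apply, Module.End.mul_apply, Algebra.lsmul_coe, Pi.sub_apply,
      Pi.smul_apply, hAction_succ, Derivation.leibniz, smul_eq_mul]
    ring

/-- The action of `k⟨g, h⟩`. -/
def actionT (k : Type*) [Field k] : T k →ₐ[k] Module.End k (ℕ → BFdB k) :=
  FreeAlgebra.lift k ![Algebra.lsmul k k _ (u k 1), hAction k]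

theorem actionT_E (k : Type*) [Field k] (n : ℕ) :
    actionT k (E k (omegaWord n)) = Algebra.lsmul k k _ (u k n.succPNat) := by
  induction n with
  | zero =>
    rw [E_omegaWord_zero, actionT, FreeAlgebra.lift_ι_apply]
    rfl
  | succ n ih =>
    have h : actionT k (FreeAlgebra.ι k 1) = hAction k := FreeAlgebra.lift_ι_apply _ _
    rw [E_omegaWord_succ, map_sub, map_mul, map_mul, ih, h, lsmul_mul_hAction, shiftDer_u]
    rfl

/-- The action of `T̄`. -/
def action (k : Type*) [Field k] : Tbar k →ₐ[k] Module.End k (ℕ → BFdB k) :=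
  liftTbar (actionT k) fun m n => by
    rw [actionT_E, actionT_E, Commute, SemiconjBy, ← map_mul, mul_comm, map_mul]

theorem action_hbar (k : Type*) [Field k] : action k (hbar k) = hAction k :=
  (liftTbar_proj _ _ _).trans (FreeAlgebra.lift_ι_apply _ _)

theorem action_toTbar {k : Type*} [Field k] (a : BFdB k) :
    action k (toTbar k a) = Algebra.lsmul k k _ a := by
  revert a
  refine AlgHom.congr_fun (φ₁ := (action k).comp (toTbar k)) (BFdB.algHom_ext fun n => ?_)
  rw [AlgHom.comp_apply, toTbar_u, Ebar, action, liftTbar_proj, actionT_E, PNat.succPNat_natPred]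

theorem toTbar_injective (k : Type*) [Field k] : Function.Injective (toTbar k) := by
  intro a b h
  -- Multiplication by a is recovered from any entry of its value on the constant sequence 1.
  have h1 := congrFun (LinearMap.congr_fun (congrArg (action k) h) fun _ => 1) 0
  simpa [action_toTbar] using h1

theorem toR_bijective (k : Type*) [Field k] : Function.Bijective (toR k) :=
  ⟨fun _ _ h => toTbar_injective k (congrArg Subtype.val h), toR_surjective k⟩

/-- The series (t − δ)^i a is a polynomial in t of degree at most i. -/
theorem hAction_pow_single_of_lt {k : Type*} [Field k] (a : BFdB k) {i j : ℕ} (h : i < j) :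
    (hAction k ^ i) (Pi.single 0 a) j = 0 := by
  induction i generalizing j with
  | zero => simp [h.ne']
  | succ i ih =>
    obtain ⟨j, rfl⟩ := Nat.exists_eq_succ_of_ne_zero (by omega : j ≠ 0)
    rw [pow_succ', Module.End.mul_apply, hAction_succ, ih (by omega), ih (by omega), map_zero,
      sub_zero]

theorem hAction_pow_single_self {k : Type*} [Field k] (a : BFdB k) (i : ℕ) :
    (hAction k ^ i) (Pi.single 0 a) i = a := by
  induction i with
  | zero => simp
  | succ i ih =>
    rw [pow_succ', Module.End.mul_apply, hAction_succ, ih,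
      hAction_pow_single_of_lt a i.lt_succ_self, map_zero, sub_zero]

/-- Second coefficient of the binomial expansion of (t − δ)^{i+1} a. The integer factor is where the
characteristic enters. -/
theorem hAction_pow_succ_single {k : Type*} [Field k] (a : BFdB k) (i : ℕ) :
    (hAction k ^ (i + 1)) (Pi.single 0 a) i = - ((i + 1 : ℕ) : BFdB k) * shiftDer k a := by
  induction i with
  | zero =>
    rw [zero_add, pow_one, hAction_zero, Pi.single_eq_same]
    simp
  | succ i ih =>
    rw [pow_succ', Module.End.mul_apply, hAction_succ, ih, hAction_pow_single_self]
    push_cast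
    ring

/-! ### The Ore extension -/

/-- The linear map `(a_i) ↦ ∑ h^i a_i`. -/
def oreSum (k : Type*) [Field k] : (ℕ →₀ BFdB k) →ₗ[k] Tbar k :=
  Finsupp.lsum k fun i => LinearMap.mulLeft k (hbar k ^ i) ∘ₗ (toTbar k).toLinearMap

theorem oreSum_single {k : Type*} [Field k] (i : ℕ) (a : BFdB k) :
    oreSum k (Finsupp.single i a) = hbar k ^ i * toTbar k a := by
  simp [oreSum]

/-- The range is stable under right multiplication by h because h^i a h = h^{i+1} a + h^i δ(a). -/
theorem oreSum_surjective (k : Type*) [Field k] : Function.Surjective (oreSum k) := by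
  refine fun x => mem_of_mul_mem (LinearMap.range (oreSum k)) ?_ ?_ ?_ x
  · exact ⟨Finsupp.single 0 1, by simp [oreSum_single]⟩
  · rintro _ ⟨f, rfl⟩
    induction f using Finsupp.induction_linear with
    | zero => simp
    | add f f' hf hf' =>
      rw [map_add, add_mul]
      exact Submodule.add_mem _ hf hf'
    | single i a =>
      exact ⟨Finsupp.single i (a * u k 1), by
        rw [oreSum_single, oreSum_single, map_mul, toTbar_u_one, mul_assoc]⟩
  · rintro _ ⟨f, rfl⟩
    induction f using Finsupp.induction_linear with
    | zero => simp
    | add f f' hf hf' =>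
      rw [map_add, add_mul]
      exact Submodule.add_mem _ hf hf'
    | single i a =>
      refine ⟨Finsupp.single (i + 1) a + Finsupp.single i (shiftDer k a), ?_⟩
      rw [map_add, oreSum_single, oreSum_single, oreSum_single, mul_assoc, toTbar_mul_hbar,
        pow_succ]
      noncomm_ring

theorem action_oreSum {k : Type*} [Field k] (f : ℕ →₀ BFdB k) {N : ℕ} (hN : ∀ i, N ≤ i → f i = 0)
    (b : BFdB k) : action k (oreSum k f) (Pi.single 0 b) =
      ∑ i ∈ Finset.range N, (hAction k ^ i) (Pi.single 0 (f i * b)) := by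
  rw [oreSum, Finsupp.lsum_apply, Finsupp.sum_of_support_subset f (s := Finset.range N) _ _
    (fun i _ => LinearMap.map_zero _), map_sum, LinearMap.sum_apply]
  · refine Finset.sum_congr rfl fun i _ => ?_
    rw [LinearMap.comp_apply, LinearMap.mulLeft_apply, map_mul, map_pow, action_hbar,
      AlgHom.toLinearMap_apply, action_toTbar, Module.End.mul_apply, Algebra.lsmul_coe]
    beta_reduce
    rw [← Pi.single_smul, smul_eq_mul]
  · intro i hi
    rw [Finset.mem_range]
    by_contra! h
    exact Finsupp.mem_support_iff.1 hi (hN i h)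

theorem exists_leading_index {A : Type*} [Zero A] {f : ℕ →₀ A} (hf : f ≠ 0) :
    ∃ m, f m ≠ 0 ∧ ∀ i, m + 1 ≤ i → f i = 0 := by
  have hs : f.support.Nonempty := Finsupp.support_nonempty_iff.2 hf
  refine ⟨f.support.max' hs, Finsupp.mem_support_iff.1 (Finset.max'_mem _ _), fun i hi => ?_⟩
  by_contra h
  have := Finset.le_max' _ i (Finsupp.mem_support_iff.2 h)
  omega

/-- If m is the top index, the coefficient of t^m in the action on the constant series 1 is the top
coefficient of f. -/
theorem oreSum_injective (k : Type*) [Field k] : Function.Injective (oreSum k) := by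
  rw [injective_iff_map_eq_zero]
  intro f hf
  by_contra hne
  obtain ⟨m, hm, hN⟩ := exists_leading_index hne
  have h1 := congrFun (action_oreSum f hN 1) m
  rw [hf, map_zero, Finset.sum_apply, Finset.sum_range_succ, Finset.sum_eq_zero, zero_add,
    hAction_pow_single_self, mul_one] at h1
  · exact hm h1.symm
  · intro i hi
    exact hAction_pow_single_of_lt _ (Finset.mem_range.1 hi)

theorem hbar_not_mem_R (k : Type*) [Field k] : hbar k ∉ R k := by
  intro h
  obtain ⟨a, ha⟩ := toR_surjective k ⟨_, h⟩
  have h1 : oreSum k (Finsupp.single 0 a) = oreSum k (Finsupp.single 1 1) := by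
    rw [oreSum_single, oreSum_single, pow_zero, one_mul, pow_one, map_one, mul_one]
    exact congrArg Subtype.val ha
  have h2 := DFunLike.congr_fun (oreSum_injective k h1) 1
  simp at h2

/-- In characteristic zero, the centralizer of `g` is `R`. -/
theorem mem_R_of_commute {k : Type*} [Field k] [CharZero k] {x : Tbar k}
    (hx : Commute x (Ebar k 0)) : x ∈ R k := by
  obtain ⟨f, rfl⟩ := oreSum_surjective k x
  by_cases hf : f = 0
  · rw [hf, map_zero]
    exact zero_mem _
  obtain ⟨m, hm, hN⟩ := exists_leading_index hf
  cases m with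
  | zero =>
    have : f = Finsupp.single 0 (f 0) := by
      ext i
      cases i with
      | zero => simp
      | succ i => rw [hN _ (by omega), Finsupp.single_eq_of_ne (by omega)]
    rw [this, oreSum_single, pow_zero, one_mul]
    exact toTbar_mem_R k _
  | succ m =>
    exfalso
    have key : ∀ b, action k (oreSum k f) (Pi.single 0 b) m =
        f m * b - ((m + 1 : ℕ) : BFdB k) * shiftDer k (f (m + 1) * b) := by
      intro b
      rw [action_oreSum f hN b, Finset.sum_apply, Finset.sum_range_succ, Finset.sum_range_succ,
        Finset.sum_eq_zero, zero_add, hAction_pow_single_self, hAction_pow_succ_single]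
      · ring
      · intro i hi
        exact hAction_pow_single_of_lt _ (Finset.mem_range.1 hi)
    -- Compare the coefficients of t^m of xg and gx on the constant series 1. The terms with f_m and
    -- δ(f_{m+1}) cancel, leaving (m+1) f_{m+1} u_2 = 0.
    have h1 := congrFun (LinearMap.congr_fun (congrArg (action k) hx.eq) (Pi.single 0 1)) m
    rw [map_mul, map_mul, Module.End.mul_apply, Module.End.mul_apply, ← toTbar_u_one,
      action_toTbar, Algebra.lsmul_coe] at h1
    beta_reduce at h1
    rw [← Pi.single_smul, Pi.smul_apply, key,
      key, smul_eq_mul, smul_eq_mul, mul_one, mul_one, mul_one, Derivation.leibniz, shiftDer_u,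
      smul_eq_mul, smul_eq_mul] at h1
    have h2 : ((m + 1 : ℕ) : BFdB k) * (f (m + 1) * u k (1 + 1)) = 0 := by
      linear_combination -h1
    have : CharZero (BFdB k) := charZero_of_injective_algebraMap (algebraMap k (BFdB k)).injective
    refine mul_ne_zero (Nat.cast_ne_zero.2 m.succ_ne_zero) (mul_ne_zero hm (u_ne_zero k _)) h2

theorem commutator_hbar_mem_R {k : Type*} [Field k] {a : Tbar k} (ha : a ∈ R k) :
    a * hbar k - hbar k * a ∈ R k := by
  obtain ⟨b, hb⟩ := toR_surjective k ⟨a, ha⟩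
  have : toTbar k b = a := congrArg Subtype.val hb
  rw [← this, toTbar_mul_hbar, add_sub_cancel_left]
  exact toTbar_mem_R k _

/-- The derivation `ad_r h` of `R`. -/
def adR (k : Type*) [Field k] : (R k).toSubring →+ (R k).toSubring where
  toFun a := ⟨a * hbar k - hbar k * a, commutator_hbar_mem_R a.2⟩
  map_zero' := Subtype.ext (by simp)
  map_add' a b := Subtype.ext (by
    simp only [Subring.coe_add, add_mul, mul_add]
    abel)

theorem coe_adR {k : Type*} [Field k] (a : (R k).toSubring) :
    (adR k a : Tbar k) = a * hbar k - hbar k * a :=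
  rfl

theorem adR_ne_zero (k : Type*) [Field k] : adR k ≠ 0 := by
  intro h
  have h1 : Ebar k 1 = 0 := by
    rw [Ebar_succ]
    exact congrArg Subtype.val (DFunLike.congr_fun h ⟨Ebar k 0, Ebar_mem_R k 0⟩)
  rw [← toTbar_u_succPNat, ← map_zero (toTbar k)] at h1
  exact u_ne_zero k _ (toTbar_injective k h1)

theorem isOreExtension_R (k : Type*) [Field k] :
    IsOreExtension (R k).toSubring (hbar k) (RingHom.id _) (adR k) where
  leibniz a b := Subtype.ext (by
    simp only [coe_adR, Subring.coe_add, Subring.coe_mul, RingHom.id_apply, sub_mul, mul_sub, mul_assoc]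
    abel)
  not_mem := hbar_not_mem_R k
  mul_x a := by
    rw [coe_adR, RingHom.id_apply]
    abel
  basis := by
    let e : BFdB k ≃ (R k).toSubring := Equiv.ofBijective (toR k) (toR_bijective k)
    have he : e 0 = 0 := map_zero (toR k)
    have hcomp : (fun f : ℕ →₀ (R k).toSubring => f.sum fun i a => hbar k ^ i * (a : Tbar k)) ∘
        Finsupp.mapRange.equiv e he = oreSum k := by
      funext f
      rw [Function.comp_apply, Finsupp.mapRange.equiv_apply, Finsupp.sum_mapRange_index]
      · rfl
      · simp
    rw [← Function.Bijective.of_comp_iff _ (Finsupp.mapRange.equiv e he).bijective, hcomp]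
    exact ⟨oreSum_injective k, oreSum_surjective k⟩

/-! ### The Faà di Bruno bialgebra as a sub-bialgebra -/

open CoalgebraStruct in
/-- A structure that embeds into a bialgebra is a bialgebra. -/
theorem IsBialgebra.of_injective {k A B : Type*} [Field k] [Ring A] [Algebra k A] [Ring B]
    [Algebra k B] [CoalgebraStruct k A] [CoalgebraStruct k B] (hB : IsBialgebra k B)
    (f : A →ₐ[k] B) (hf : Function.Injective f)
    (hcounit : ∀ a, counit (R := k) (f a) = counit (R := k) a)
    (hcomul : ∀ a, comul (R := k) (f a) = Algebra.TensorProduct.map f f (comul (R := k) a)) :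
    IsBialgebra k A := by
  -- Over a field f ⊗ f and f ⊗ f ⊗ f stay injective, so each law can be tested after applying them.
  have hff : Function.Injective (Algebra.TensorProduct.map f f) :=
    TensorProduct.map_injective_of_flat_flat f.toLinearMap f.toLinearMap hf hf
  have hfff : Function.Injective (TensorProduct.map f.toLinearMap
      (TensorProduct.map f.toLinearMap f.toLinearMap)) :=
    TensorProduct.map_injective_of_flat_flat _ _ hf hff
  have hl : ∀ t : A ⊗[k] A, TensorProduct.map f.toLinearMap
      (TensorProduct.map f.toLinearMap f.toLinearMap)
      (TensorProduct.assoc k A A A ((comul (R := k) (A := A)).rTensor A t)) =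
      TensorProduct.assoc k B B B ((comul (R := k) (A := B)).rTensor B
        (Algebra.TensorProduct.map f f t)) := by
    intro t
    induction t with
    | zero => simp
    | add s t hs ht => simp only [map_add, hs, ht]
    | tmul a b =>
      rw [Algebra.TensorProduct.map_tmul, LinearMap.rTensor_tmul, LinearMap.rTensor_tmul, hcomul]
      induction comul (R := k) a with
      | zero => simp
      | add s t hs ht => simp only [map_add, TensorProduct.add_tmul, hs, ht]
      | tmul c d => simp
  have hr : ∀ t : A ⊗[k] A, TensorProduct.map f.toLinearMap
      (TensorProduct.map f.toLinearMap f.toLinearMap)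
      ((comul (R := k) (A := A)).lTensor A t) =
      (comul (R := k) (A := B)).lTensor B (Algebra.TensorProduct.map f f t) := by
    intro t
    induction t with
    | zero => simp
    | add s t hs ht => simp only [map_add, hs, ht]
    | tmul a b =>
      rw [Algebra.TensorProduct.map_tmul, LinearMap.lTensor_tmul, LinearMap.lTensor_tmul, hcomul]
      rfl
  refine ⟨?_, ?_, ?_, ?_, fun a b => ?_, ?_, fun a b => ?_⟩
  · refine LinearMap.ext fun a => hfff ?_
    refine (hl _).trans ((Eq.trans ?_ (LinearMap.congr_fun hB.coassoc (f a))).trans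
      (Eq.trans ?_ (hr _).symm))
    · rw [← hcomul]
      rfl
    · rw [← hcomul]
      rfl
  · refine LinearMap.ext fun a => Module.Flat.lTensor_preserves_injective_linearMap (M := k)
      f.toLinearMap hf ?_
    have h : ∀ t : A ⊗[k] A, f.toLinearMap.lTensor k ((counit (R := k) (A := A)).rTensor A t) =
        (counit (R := k) (A := B)).rTensor B (Algebra.TensorProduct.map f f t) := by
      intro t
      induction t with
      | zero => simp
      | add s t hs ht => simp only [map_add, hs, ht]
      | tmul a b => simp [hcounit]
    refine (h _).trans (Eq.trans ?_ (LinearMap.congr_fun hB.rTensor_counit_comp_comul (f a)))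
    rw [← hcomul]
    rfl
  · refine LinearMap.ext fun a => Module.Flat.rTensor_preserves_injective_linearMap (M := k)
      f.toLinearMap hf ?_
    have h : ∀ t : A ⊗[k] A, f.toLinearMap.rTensor k ((counit (R := k) (A := A)).lTensor A t) =
        (counit (R := k) (A := B)).lTensor B (Algebra.TensorProduct.map f f t) := by
      intro t
      induction t with
      | zero => simp
      | add s t hs ht => simp only [map_add, hs, ht]
      | tmul a b => simp [hcounit]
    refine (h _).trans (Eq.trans ?_ (LinearMap.congr_fun hB.lTensor_counit_comp_comul (f a)))
    rw [← hcomul]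
    rfl
  · rw [← hcounit, map_one, hB.counit_one]
  · rw [← hcounit, map_mul, hB.counit_mul, hcounit, hcounit]
  · apply hff
    rw [← hcomul, map_one, hB.comul_one, map_one]
  · apply hff
    rw [← hcomul, map_mul, hB.comul_mul, hcomul, hcomul, map_mul]

/-- Coassociativity of the Bell formula comes from T̄, without any identity between Bell
polynomials. -/
theorem isBialgebra_BFdB (k : Type*) [Field k] : IsBialgebra k (BFdB k) :=
  (isBialgebra_Tbar k).of_injective (toTbar k) (toTbar_injective k) counitTbar_toTbar
    comulTbar_toTbar

theorem isSubbialgebra_R (k : Type*) [Field k] : IsSubbialgebra (R k) := by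
  intro x hx
  obtain ⟨a, ha⟩ := toR_surjective k ⟨x, hx⟩
  obtain rfl : toTbar k a = x := congrArg Subtype.val ha
  have h := comulTbar_toTbar a
  refine (congrArg (· ∈ LinearMap.range _) h).mpr ?_
  induction comulBFdB k a with
  | zero => rw [map_zero]; exact zero_mem _
  | add s t hs ht => rw [map_add]; exact add_mem hs ht
  | tmul b c =>
    exact ⟨(⟨_, toTbar_mem_R k b⟩ : Subalgebra.toSubmodule (R k)) ⊗ₜ
      (⟨_, toTbar_mem_R k c⟩ : Subalgebra.toSubmodule (R k)), rfl⟩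

/-- The isomorphism of the Faà di Bruno bialgebra with `R`. -/
def bialgEquivR (k : Type*) [Field k] (hR : IsSubbialgebra (R k)) :
    letI : CoalgebraStruct k (R k) := hR.coalgebraStruct
    BFdB k ≃ₐc[k] R k :=
  letI : CoalgebraStruct k (R k) := hR.coalgebraStruct
  { AlgEquiv.ofBijective (toR k) (toR_bijective k) with
    map_smul' := map_smul (toR k)
    counit_comp := LinearMap.ext fun a => counitTbar_toTbar a
    map_comp_comul := LinearMap.ext fun a => by
      apply inclTensor_injective (R k)
      refine Eq.trans ?_ (hR.inclTensor_comul (toR k a)).symm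
      refine Eq.trans ?_ (comulTbar_toTbar a).symm
      change inclTensor (R k) (TensorProduct.map (toR k).toLinearMap (toR k).toLinearMap
        (comulBFdB k a)) = _
      induction comulBFdB k a with
      | zero => simp
      | add s t hs ht => simp only [map_add, hs, ht]
      | tmul b c => rfl }

theorem coe_bialgEquivR {k : Type*} [Field k] (hR : IsSubbialgebra (R k)) (a : BFdB k) :
    letI : CoalgebraStruct k (R k) := hR.coalgebraStruct
    (bialgEquivR k hR a : Tbar k) = toTbar k a :=
  rfl

/-! ### Pointedness -/

section Slice

open CoalgebraStruct

variable {k C : Type*} [Field k] [AddCommGroup C] [Module k C]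

/-- The map `a ⊗ b ↦ f(a) b`. -/
def contractLeft (f : C →ₗ[k] k) : C ⊗[k] C →ₗ[k] C :=
  TensorProduct.lid k C ∘ₗ f.rTensor C

theorem contractLeft_tmul (f : C →ₗ[k] k) (a b : C) : contractLeft f (a ⊗ₜ b) = f a • b := by
  simp [contractLeft]

variable [CoalgebraStruct k C]

theorem IsSubcoalgebra.contractLeft_mem {D : Submodule k C} (hD : IsSubcoalgebra D)
    (f : C →ₗ[k] k) {x : C} (hx : x ∈ D) : contractLeft f (comul (R := k) x) ∈ D := by
  obtain ⟨t, ht⟩ := hD x hx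
  rw [← ht]
  clear ht
  induction t with
  | zero => rw [map_zero, map_zero]; exact zero_mem _
  | add s t hs ht => rw [map_add, map_add]; exact add_mem hs ht
  | tmul a b =>
    rw [TensorProduct.map_tmul, contractLeft_tmul]
    exact D.smul_mem _ b.2

/-- Consequence of the counit law, used to see that a slice of Δ(x) is nonzero when f(x) ≠ 0. -/
theorem counit_contractLeft (h : (counit (R := k) (A := C)).lTensor C ∘ₗ comul =
    (TensorProduct.mk k C k).flip 1) (f : C →ₗ[k] k) (x : C) :
    counit (R := k) (contractLeft f (comul (R := k) x)) = f x := by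
  have h1 : ∀ t : C ⊗[k] C, counit (R := k) (contractLeft f t) =
      f (TensorProduct.rid k C ((counit (R := k) (A := C)).lTensor C t)) := by
    intro t
    induction t with
    | zero => simp
    | add s t hs ht => simp only [map_add, hs, ht]
    | tmul a b => simp [contractLeft_tmul, mul_comm]
  have h2 := LinearMap.congr_fun h x
  rw [LinearMap.comp_apply] at h2
  rw [h1, h2]
  simp

theorem ne_zero_of_mem_grouplikes {c : C} (hc : c ∈ grouplikes k C) : c ≠ 0 := by
  rintro rfl
  exact zero_ne_one ((map_zero (counit (R := k) (A := C))).symm.trans hc.2)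

theorem isSubcoalgebra_span_singleton {c : C} (hc : c ∈ grouplikes k C) :
    IsSubcoalgebra (Submodule.span k {c}) := by
  intro x hx
  obtain ⟨r, rfl⟩ := Submodule.mem_span_singleton.1 hx
  have hc' := Submodule.mem_span_singleton_self (R := k) c
  refine ⟨r • ((⟨c, hc'⟩ : Submodule.span k {c}) ⊗ₜ ⟨c, hc'⟩), ?_⟩
  rw [map_smul, map_smul, hc.1]
  rfl

theorem span_grouplikes_le_coradical : Submodule.span k (grouplikes k C) ≤ coradical k C := by
  rw [Submodule.span_le]
  intro c hc
  have hatom := nonzero_span_atom (K := k) c (ne_zero_of_mem_grouplikes hc)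
  exact (le_sSup (show Submodule.span k {c} ∈ {D | IsSimpleSubcoalgebra D} from
    ⟨isSubcoalgebra_span_singleton hc, hatom.1, fun D' _ h => hatom.le_iff.1 h⟩) :
      Submodule.span k {c} ≤ coradical k C) (Submodule.mem_span_singleton_self c)

end Slice

/-- The image in `T̄` of a word. -/
def word (k : Type*) [Field k] (w : List (Fin 2)) : Tbar k :=
  (w.map fun i => proj k (FreeAlgebra.ι k i)).prod

theorem word_cons_zero (k : Type*) [Field k] (w : List (Fin 2)) :
    word k (0 :: w) = Ebar k 0 * word k w := by
  simp [word, Ebar_zero]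

theorem word_cons_one (k : Type*) [Field k] (w : List (Fin 2)) :
    word k (1 :: w) = hbar k * word k w := by
  simp [word, hbar]

/-- The span of the words with less than `n` letters `h`. -/
def hFiltration (k : Type*) [Field k] (n : ℕ) : Submodule k (Tbar k) :=
  Submodule.span k {x | ∃ w : List (Fin 2), w.count 1 < n ∧ word k w = x}

theorem word_mem_hFiltration {k : Type*} [Field k] {w : List (Fin 2)} {n : ℕ}
    (h : w.count 1 < n) : word k w ∈ hFiltration k n :=
  Submodule.subset_span ⟨w, h, rfl⟩

theorem hFiltration_mono (k : Type*) [Field k] : Monotone (hFiltration k) := fun _ _ h =>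
  Submodule.span_mono fun _ ⟨w, hw, hx⟩ => ⟨w, hw.trans_le h, hx⟩

theorem g_mul_mem_hFiltration {k : Type*} [Field k] {n : ℕ} {x : Tbar k}
    (hx : x ∈ hFiltration k n) : Ebar k 0 * x ∈ hFiltration k n := by
  suffices hFiltration k n ≤ (hFiltration k n).comap (LinearMap.mulLeft k (Ebar k 0)) from this hx
  refine Submodule.span_le.2 ?_
  rintro _ ⟨w, hw, rfl⟩
  rw [SetLike.mem_coe, Submodule.mem_comap, LinearMap.mulLeft_apply, ← word_cons_zero]
  exact word_mem_hFiltration (by simpa using hw)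

theorem h_mul_mem_hFiltration {k : Type*} [Field k] {n : ℕ} {x : Tbar k}
    (hx : x ∈ hFiltration k n) : hbar k * x ∈ hFiltration k (n + 1) := by
  suffices hFiltration k n ≤ (hFiltration k (n + 1)).comap (LinearMap.mulLeft k (hbar k)) from
    this hx
  refine Submodule.span_le.2 ?_
  rintro _ ⟨w, hw, rfl⟩
  rw [SetLike.mem_coe, Submodule.mem_comap, LinearMap.mulLeft_apply, ← word_cons_one]
  exact word_mem_hFiltration (by simpa using hw)

theorem exists_mem_hFiltration {k : Type*} [Field k] (x : Tbar k) : ∃ n, x ∈ hFiltration k n := by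
  have hx : x ∈ Submodule.span k (Set.range (word k)) := by
    refine mem_of_mul_mem (Submodule.span k (Set.range (word k))) (Submodule.subset_span ⟨[], rfl⟩)
      (fun y hy => ?_) (fun y hy => ?_) x
    · suffices Submodule.span k (Set.range (word k)) ≤
        (Submodule.span k (Set.range (word k))).comap (LinearMap.mulRight k (Ebar k 0)) from this hy
      refine Submodule.span_le.2 ?_
      rintro _ ⟨w, rfl⟩
      exact Submodule.subset_span ⟨w ++ [0], by simp [word, Ebar_zero]⟩
    · suffices Submodule.span k (Set.range (word k)) ≤
        (Submodule.span k (Set.range (word k))).comap (LinearMap.mulRight k (hbar k)) from this hy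
      refine Submodule.span_le.2 ?_
      rintro _ ⟨w, rfl⟩
      exact Submodule.subset_span ⟨w ++ [1], by simp [word, hbar]⟩
  induction hx using Submodule.span_induction with
  | mem x hx =>
    obtain ⟨w, rfl⟩ := hx
    exact ⟨_, word_mem_hFiltration (Nat.lt_succ_self _)⟩
  | zero => exact ⟨0, zero_mem _⟩
  | add x y _ _ hx hy =>
    obtain ⟨m, hm⟩ := hx
    obtain ⟨n, hn⟩ := hy
    exact ⟨max m n, add_mem (hFiltration_mono k (le_max_left m n) hm)
      (hFiltration_mono k (le_max_right m n) hn)⟩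
  | smul r x _ hx =>
    obtain ⟨m, hm⟩ := hx
    exact ⟨m, Submodule.smul_mem _ r hm⟩

/-- The left factor is absorbed into the functional; inductions over words therefore let f vary. -/
theorem contractLeft_tmul_mul {k A : Type*} [Field k] [Ring A] [Algebra k A] (f : A →ₗ[k] k)
    (a b : A) (t : A ⊗[k] A) : contractLeft f ((a ⊗ₜ b) * t) =
      b * contractLeft (f ∘ₗ LinearMap.mulLeft k a) t := by
  induction t with
  | zero => simp
  | add s t hs ht => rw [mul_add, map_add, map_add, hs, ht, mul_add]
  | tmul c d => simp [contractLeft_tmul]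

theorem contractLeft_comulTbar_word_cons_zero {k : Type*} [Field k] (f : Tbar k →ₗ[k] k)
    (w : List (Fin 2)) : contractLeft f (comulTbar k (word k (0 :: w))) =
      Ebar k 0 *
        contractLeft (f ∘ₗ LinearMap.mulLeft k (Ebar k 0)) (comulTbar k (word k w)) := by
  rw [word_cons_zero, map_mul, comulTbar_g, contractLeft_tmul_mul]

theorem contractLeft_comulTbar_word_cons_one {k : Type*} [Field k] (f : Tbar k →ₗ[k] k)
    (w : List (Fin 2)) : contractLeft f (comulTbar k (word k (1 :: w))) =
      hbar k * contractLeft f (comulTbar k (word k w)) + Ebar k 0 *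
        contractLeft (f ∘ₗ LinearMap.mulLeft k (hbar k)) (comulTbar k (word k w)) := by
  rw [word_cons_one, map_mul, comulTbar_h, add_mul, map_add, contractLeft_tmul_mul,
    contractLeft_tmul_mul]
  rw [LinearMap.mulLeft_one, LinearMap.comp_id]

theorem contractLeft_comulTbar_word_mem {k : Type*} [Field k] (w : List (Fin 2))
    (f : Tbar k →ₗ[k] k) :
    contractLeft f (comulTbar k (word k w)) ∈ hFiltration k (w.count 1 + 1) := by
  induction w generalizing f with
  | nil =>
    rw [show word k [] = 1 from rfl, map_one, Algebra.TensorProduct.one_def, contractLeft_tmul]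
    exact Submodule.smul_mem _ _ (word_mem_hFiltration (w := []) (by simp))
  | cons i w ih =>
    obtain rfl | rfl : i = 0 ∨ i = 1 := by omega
    · rw [contractLeft_comulTbar_word_cons_zero, List.count_cons_of_ne (by decide)]
      exact g_mul_mem_hFiltration (ih _)
    · rw [contractLeft_comulTbar_word_cons_one, List.count_cons_self]
      exact add_mem (h_mul_mem_hFiltration (ih _))
        (hFiltration_mono k (Nat.le_succ _) (g_mul_mem_hFiltration (ih _)))

/-- Each h of the word goes to one side of the tensor product. Terms with no h on the left are
killed by f, so the right factor has lost at least one h. -/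
theorem contractLeft_comulTbar_word_mem_of_vanish {k : Type*} [Field k] (w : List (Fin 2))
    (f : Tbar k →ₗ[k] k) (hf : ∀ x ∈ hFiltration k 1, f x = 0) :
    contractLeft f (comulTbar k (word k w)) ∈ hFiltration k (w.count 1) := by
  induction w generalizing f with
  | nil =>
    have h1 : f 1 = 0 := hf 1 (word_mem_hFiltration (w := []) (by simp))
    rw [show word k [] = 1 from rfl, map_one, Algebra.TensorProduct.one_def, contractLeft_tmul, h1,
      zero_smul]
    exact zero_mem _
  | cons i w ih =>
    obtain rfl | rfl : i = 0 ∨ i = 1 := by omega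
    · rw [contractLeft_comulTbar_word_cons_zero, List.count_cons_of_ne (by decide)]
      exact g_mul_mem_hFiltration (ih _ fun x hx => hf _ (g_mul_mem_hFiltration hx))
    · rw [contractLeft_comulTbar_word_cons_one, List.count_cons_self]
      exact add_mem (h_mul_mem_hFiltration (ih _ hf))
        (g_mul_mem_hFiltration (contractLeft_comulTbar_word_mem w _))

theorem contractLeft_comulTbar_mem {k : Type*} [Field k] {n : ℕ} {x : Tbar k}
    (hx : x ∈ hFiltration k (n + 1)) (f : Tbar k →ₗ[k] k)
    (hf : ∀ x ∈ hFiltration k 1, f x = 0) :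
    contractLeft f (comulTbar k x) ∈ hFiltration k n := by
  suffices hFiltration k (n + 1) ≤
    (hFiltration k n).comap (contractLeft f ∘ₗ (comulTbar k).toLinearMap) from this hx
  refine Submodule.span_le.2 ?_
  rintro _ ⟨w, hw, rfl⟩
  exact hFiltration_mono k (Nat.lt_succ_iff.1 hw)
    (contractLeft_comulTbar_word_mem_of_vanish w f hf)

/-- A nonzero subcoalgebra meets the lowest piece of the filtration. -/
theorem exists_mem_hFiltration_one {k : Type*} [Field k] {D : Submodule k (Tbar k)}
    (hD : IsSubcoalgebra D) (hne : D ≠ ⊥) : ∃ x ∈ D, x ≠ 0 ∧ x ∈ hFiltration k 1 := by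
  obtain ⟨x, hx, hx0⟩ := Submodule.exists_mem_ne_zero_of_ne_bot hne
  obtain ⟨n, hn⟩ := exists_mem_hFiltration x
  induction n generalizing x with
  | zero => exact ⟨x, hx, hx0, hFiltration_mono k zero_le_one hn⟩
  | succ n ih =>
    by_cases h1 : x ∈ hFiltration k 1
    · exact ⟨x, hx, hx0, h1⟩
    -- The slice by f stays in D, drops one filtration step, and is nonzero because its counit is
    -- f(x).
    obtain ⟨f, hfx, hf⟩ := Submodule.exists_le_ker_of_notMem h1
    refine ih (contractLeft f (comulTbar k x)) (hD.contractLeft_mem f hx) (fun h0 => hfx ?_)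
      (contractLeft_comulTbar_mem hn f hf)
    have h2 := counit_contractLeft (isBialgebra_Tbar k).lTensor_counit_comp_comul f x
    rw [← h2]
    exact (congrArg (counitTbar k) h0).trans (map_zero _)

theorem pow_mem_grouplikes (k : Type*) [Field k] (n : ℕ) :
    Ebar k 0 ^ n ∈ grouplikes k (Tbar k) := by
  constructor
  · change comulTbar k _ = _
    rw [map_pow, comulTbar_g, Algebra.TensorProduct.tmul_pow]
  · change counitTbar k _ = _
    rw [map_pow, counitTbar_g, one_pow]

/-- The algebra map `T̄ → k[X]` with `g ↦ X` and `h ↦ 0`. -/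
def toPolynomial (k : Type*) [Field k] : Tbar k →ₐ[k] Polynomial k :=
  liftTbar (FreeAlgebra.lift k ![Polynomial.X, 0]) fun _ _ => Commute.all _ _

theorem toPolynomial_g (k : Type*) [Field k] : toPolynomial k (Ebar k 0) = Polynomial.X := by
  rw [toPolynomial, Ebar_zero, liftTbar_proj]
  simp

theorem hFiltration_one_le (k : Type*) [Field k] :
    hFiltration k 1 ≤ Submodule.span k (Set.range fun n : ℕ => Ebar k 0 ^ n) := by
  refine Submodule.span_mono ?_
  rintro _ ⟨w, hw, rfl⟩
  refine ⟨w.length, ?_⟩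
  induction w with
  | nil => simp [word]
  | cons i w ih =>
    obtain rfl | rfl : i = 0 ∨ i = 1 := by omega
    · rw [word_cons_zero, ← ih (by simpa using hw)]
      exact pow_succ' _ _
    · simp at hw

/-- On k[g] the powers of g are grouplike, so slicing by the m-th coefficient isolates the
g^m-component. -/
theorem contractLeft_coeff_toPolynomial {k : Type*} [Field k] {x : Tbar k}
    (hx : x ∈ hFiltration k 1) (m : ℕ) :
    contractLeft (Polynomial.lcoeff k m ∘ₗ (toPolynomial k).toLinearMap) (comulTbar k x) =
      (toPolynomial k x).coeff m • Ebar k 0 ^ m := by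
  replace hx := hFiltration_one_le k hx
  induction hx using Submodule.span_induction with
  | mem x hx =>
    obtain ⟨n, rfl⟩ := hx
    have h := (pow_mem_grouplikes k n).1
    change comulTbar k _ = _ at h
    beta_reduce
    rw [h, contractLeft_tmul, LinearMap.comp_apply, AlgHom.toLinearMap_apply, map_pow,
      toPolynomial_g, Polynomial.lcoeff_apply, Polynomial.coeff_X_pow]
    split_ifs with h
    · rw [h]
    · rw [zero_smul, zero_smul]
  | zero => simp
  | add x y _ _ hx hy => simp only [map_add, hx, hy, Polynomial.coeff_add, add_smul]
  | smul r x _ hx => simp only [map_smul, hx, Polynomial.coeff_smul, smul_assoc]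

theorem aeval_toPolynomial {k : Type*} [Field k] {x : Tbar k} (hx : x ∈ hFiltration k 1) :
    Polynomial.aeval (Ebar k 0) (toPolynomial k x) = x := by
  replace hx := hFiltration_one_le k hx
  induction hx using Submodule.span_induction with
  | mem x hx =>
    obtain ⟨n, rfl⟩ := hx
    simp [toPolynomial_g]
  | zero => simp
  | add x y _ _ hx hy => rw [map_add, map_add, hx, hy]
  | smul r x _ hx => rw [map_smul, map_smul, hx]

/-- Every nonzero subcoalgebra contains some g^m, so a simple one is the line spanned by it. -/
theorem isPointed_Tbar (k : Type*) [Field k] : IsPointed k (Tbar k) := by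
  refine le_antisymm (sSup_le ?_) span_grouplikes_le_coradical
  rintro D ⟨hD, hne, hsimple⟩
  obtain ⟨x, hxD, hx0, hx1⟩ := exists_mem_hFiltration_one hD hne
  obtain ⟨m, hm⟩ : ∃ m, (toPolynomial k x).coeff m ≠ 0 := by
    by_contra! h
    apply hx0
    rw [← aeval_toPolynomial hx1, (Polynomial.ext h : toPolynomial k x = 0), map_zero]
  have hg := pow_mem_grouplikes k m
  have hmem : Ebar k 0 ^ m ∈ D := by
    have h := hD.contractLeft_mem (Polynomial.lcoeff k m ∘ₗ (toPolynomial k).toLinearMap) hxD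
    exact (D.smul_mem_iff hm).1 ((contractLeft_coeff_toPolynomial hx1 m) ▸ h)
  rcases hsimple _ (isSubcoalgebra_span_singleton hg)
    ((Submodule.span_singleton_le_iff_mem _ _).2 hmem) with h | h
  · exact absurd (Submodule.span_singleton_eq_bot.1 h) (ne_zero_of_mem_grouplikes hg)
  · rw [← h]
    exact Submodule.span_mono (Set.singleton_subset_iff.2 hg)

/-- A commutative subalgebra containing R centralizes g = E_0. -/
theorem maximal_R {k : Type*} [Field k] [CharZero k] :
    Maximal (fun D : Subalgebra k (Tbar k) => IsSubbialgebra D ∧ IsCommutativeSubalgebra D)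
      (R k) :=
  ⟨⟨isSubbialgebra_R k, isCommutativeSubalgebra_R k⟩, fun _ hD hle _ hx =>
    mem_R_of_commute (hD.2 _ hx _ (hle (Ebar_mem_R k 0)))⟩

end FaaDiBrunoOre

end

theorem mainTheorem3 (k : Type*) [Field k] :
    ∃ C : CoalgebraStruct k (FaaDiBrunoOre.Tbar k),
      letI : CoalgebraStruct k (FaaDiBrunoOre.Tbar k) := C
      -- the quotient is a pointed bialgebra, and the projection is a morphism of bialgebras
      FaaDiBrunoOre.IsBialgebra k (FaaDiBrunoOre.Tbar k) ∧
      (∃ p : FaaDiBrunoOre.T k →ₐc[k] FaaDiBrunoOre.Tbar k, ∀ x, p x = FaaDiBrunoOre.proj k x) ∧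
      FaaDiBrunoOre.IsPointed k (FaaDiBrunoOre.Tbar k) ∧
      -- it is the Ore extension `R[h; ad_r h]`, where `ad_r h` is a nonzero map `R → R`
      (∃ δ : (FaaDiBrunoOre.R k).toSubring →+ (FaaDiBrunoOre.R k).toSubring,
        (∀ a, (δ a : FaaDiBrunoOre.Tbar k) =
          (a : FaaDiBrunoOre.Tbar k) * FaaDiBrunoOre.hbar k -
            FaaDiBrunoOre.hbar k * (a : FaaDiBrunoOre.Tbar k)) ∧
        δ ≠ 0 ∧
        FaaDiBrunoOre.IsOreExtension (FaaDiBrunoOre.R k).toSubring (FaaDiBrunoOre.hbar k)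
          (RingHom.id _) δ) ∧
      -- `R` is a commutative sub-bialgebra, isomorphic to the Faà di Bruno bialgebra
      FaaDiBrunoOre.IsCommutativeSubalgebra (FaaDiBrunoOre.R k) ∧
      FaaDiBrunoOre.IsBialgebra k (FaaDiBrunoOre.BFdB k) ∧
      (∃ hR : FaaDiBrunoOre.IsSubbialgebra (FaaDiBrunoOre.R k),
        letI : CoalgebraStruct k (FaaDiBrunoOre.R k) := hR.coalgebraStruct
        ∃ e : FaaDiBrunoOre.BFdB k ≃ₐc[k] FaaDiBrunoOre.R k,
          ∀ n : ℕ, (e (FaaDiBrunoOre.u k n.succPNat) : FaaDiBrunoOre.Tbar k) =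
            FaaDiBrunoOre.Ebar k n) ∧
      -- in characteristic zero, `R` is maximal
      (CharZero k →
        Maximal (fun D : Subalgebra k (FaaDiBrunoOre.Tbar k) =>
          FaaDiBrunoOre.IsSubbialgebra D ∧ FaaDiBrunoOre.IsCommutativeSubalgebra D)
          (FaaDiBrunoOre.R k)) := by
  refine ⟨FaaDiBrunoOre.coalgebraStructTbar k, FaaDiBrunoOre.isBialgebra_Tbar k,
    ⟨FaaDiBrunoOre.projBialgHom k, fun _ => rfl⟩, FaaDiBrunoOre.isPointed_Tbar k,
    ⟨FaaDiBrunoOre.adR k, FaaDiBrunoOre.coe_adR, FaaDiBrunoOre.adR_ne_zero k,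
      FaaDiBrunoOre.isOreExtension_R k⟩,
    FaaDiBrunoOre.isCommutativeSubalgebra_R k, FaaDiBrunoOre.isBialgebra_BFdB k,
    ⟨FaaDiBrunoOre.isSubbialgebra_R k, FaaDiBrunoOre.bialgEquivR k _, fun n => ?_⟩,
    fun _ => FaaDiBrunoOre.maximal_R⟩
  rw [FaaDiBrunoOre.coe_bialgEquivR, FaaDiBrunoOre.toTbar_u_succPNat]
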